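/- Let $\widetilde{SU}(1,1)$ be the universal cover of the group $SU(1,1)$ of matrices $\begin{pmatrix} z & w\\ \bar w & \bar z\end{pmatrix}$ with $|z|^2-|w|^2=1$; concretely $$\widetilde{SU}(1,1)=\{(w,\varphi,r)\in\mathbb{C}\times\mathbb{R}\times\mathbb{R}_{>0} : |w|^2=r^2-1\},$$ with covering map $(w,\varphi,r)\mapsto (z,w)=(re^{i\varphi},w)$ and the group law that lifts matrix multiplication and has identity element $(0,0,1)$. Let $e_1,\dots,e_n\ge 2$ be integers with $$n-2-\sum_{i=1}^n \frac1{e_i}>0 .$$ Let $\Pi\subset\widetilde{SU}(1,1)$ be a subgroup generated by elements $\gamma_1,\dots,\gamma_n,c$ for which $$\gamma_i c=c\gamma_i,\qquad \gamma_i^{e_i}=c\quad(1\le i\le n),\qquad \gamma_1\gamma_2\cdots\gamma_n=c^{\,n-2}$$ are defining relations (for example, $\Pi$ is the preimage of a cocompact Fuchsian group $\Gamma\subset PSU(1,1)$ of signature $(0;e_1,\dots,e_n)$, with its standard generators). Let $Z(\Pi)$ be the center of $\Pi$, and let $g\in\Pi$ be an element whose image in $\Pi/Z(\Pi)$ is nontrivial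 and of finite order. Then there is exactly one triple $(i,v,u)$ with $1\le i\le n$, $v,u\in\mathbb{Z}$ and $0<v<e_i$ such that $g$ is conjugate in $\Pi$ to $\gamma_i^{v}c^{u}$. -/

import Mathlib

/-- The matrix group `SU(1,1)`: the matrices `(z, w; w̄, z̄)` of determinant `1`. -/
def SU11 : Subgroup (Matrix.SpecialLinearGroup (Fin 2) ℂ) where
  carrier := {A | A 1 0 = (starRingEnd ℂ) (A 0 1) ∧ A 1 1 = (starRingEnd ℂ) (A 0 0)}
  mul_mem' := by
    rintro A B ⟨hA, hA'⟩ ⟨hB, hB'⟩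
    simp only [Set.mem_ofPred_eq, Matrix.SpecialLinearGroup.coe_mul, Matrix.mul_apply,
      Fin.sum_univ_two, map_add, map_mul, hA, hA', hB, hB', Complex.conj_conj]
    constructor <;> ring
  one_mem' := by simp
  inv_mem' := by
    rintro A ⟨hA, hA'⟩
    simp [Matrix.SpecialLinearGroup.coe_inv, Matrix.adjugate_fin_two, hA, hA']

/-- The points `(w, φ, r)` with `r > 0` and `|w|² = r² - 1`. The point `(w, φ, r)` lies over the
matrix of `SU(1,1)` with first row `(r e^{iφ}, w)`. -/
@[ext]
structure SU11Cover where
  w : ℂ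
  φ : ℝ
  r : ℝ
  r_pos : 0 < r
  norm_w_sq : ‖w‖ ^ 2 = r ^ 2 - 1

namespace SU11Cover

/-- The upper left entry of the matrix below a point of the cover. -/
noncomputable def z (a : SU11Cover) : ℂ := a.r * Complex.exp (a.φ * Complex.I)

theorem norm_z (a : SU11Cover) : ‖a.z‖ = a.r := by
  simp [z, Complex.norm_exp_ofReal_mul_I, abs_of_pos a.r_pos]

theorem z_ne_zero (a : SU11Cover) : a.z ≠ 0 := by
  rw [← norm_pos_iff, norm_z]; exact a.r_pos

theorem norm_w_lt (a : SU11Cover) : ‖a.w‖ < ‖a.z‖ := by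
  rw [norm_z]
  exact lt_of_pow_lt_pow_left₀ 2 a.r_pos.le (by rw [a.norm_w_sq]; linarith)

theorem det_eq (a : SU11Cover) :
    a.z * (starRingEnd ℂ) a.z - a.w * (starRingEnd ℂ) a.w = 1 := by
  rw [Complex.mul_conj, Complex.mul_conj, Complex.normSq_eq_norm_sq, Complex.normSq_eq_norm_sq,
    norm_z, a.norm_w_sq]
  push_cast; ring

/-- The upper left entry of the product matrix is `z₁ z₂ (1 + q)` with `|q| < 1`. -/
noncomputable def q (a b : SU11Cover) : ℂ := a.w * (starRingEnd ℂ) b.w / (a.z * b.z)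

theorem norm_q_lt (a b : SU11Cover) : ‖q a b‖ < 1 := by
  have hz : 0 < ‖a.z‖ * ‖b.z‖ :=
    mul_pos (norm_pos_iff.2 a.z_ne_zero) (norm_pos_iff.2 b.z_ne_zero)
  rw [q, norm_div, norm_mul, norm_mul, RCLike.norm_conj, div_lt_one hz]
  exact mul_lt_mul'' a.norm_w_lt b.norm_w_lt (norm_nonneg _) (norm_nonneg _)

theorem re_one_add_q_pos (a b : SU11Cover) : 0 < (1 + q a b).re := by
  have h := (abs_lt.1 ((Complex.abs_re_le_norm _).trans_lt (norm_q_lt a b))).1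
  simp only [Complex.add_re, Complex.one_re]
  linarith

theorem mul_one_add_q (a b : SU11Cover) :
    a.z * b.z * (1 + q a b) = a.z * b.z + a.w * (starRingEnd ℂ) b.w := by
  have := a.z_ne_zero
  have := b.z_ne_zero
  rw [q]; field_simp

/-- The lift to the cover of the matrix product of `SU(1,1)`. As `1 + q` has positive real part,
its principal argument depends continuously on the factors. -/
noncomputable instance : Mul SU11Cover where
  mul a b :=
    { w := a.z * b.w + a.w * (starRingEnd ℂ) b.z
      φ := a.φ + b.φ + (1 + q a b).arg
      r := ‖a.z * b.z + a.w * (starRingEnd ℂ) b.w‖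
      r_pos := by
        rw [← mul_one_add_q, norm_pos_iff]
        refine mul_ne_zero (mul_ne_zero a.z_ne_zero b.z_ne_zero) fun h => ?_
        have := re_one_add_q_pos a b
        rw [h] at this
        simp at this
      norm_w_sq := by
        have ha := a.det_eq
        have hb := b.det_eq
        rw [← Complex.normSq_eq_norm_sq, ← Complex.normSq_eq_norm_sq]
        have : ((Complex.normSq (a.z * b.w + a.w * (starRingEnd ℂ) b.z) : ℝ) : ℂ) =
            (Complex.normSq (a.z * b.z + a.w * (starRingEnd ℂ) b.w) : ℝ) - 1 := by
          rw [← Complex.mul_conj, ← Complex.mul_conj]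
          simp only [map_add, map_mul, Complex.conj_conj]
          linear_combination (-(b.z * (starRingEnd ℂ) b.z) + b.w * (starRingEnd ℂ) b.w) * ha - hb
        exact_mod_cast this }

noncomputable instance : One SU11Cover where
  one := ⟨0, 0, 1, one_pos, by simp⟩

noncomputable instance : Inv SU11Cover where
  inv a := ⟨-a.w, -a.φ, a.r, a.r_pos, by rw [norm_neg]; exact a.norm_w_sq⟩

theorem mul_w (a b : SU11Cover) : (a * b).w = a.z * b.w + a.w * (starRingEnd ℂ) b.z := rfl

theorem mul_φ (a b : SU11Cover) : (a * b).φ = a.φ + b.φ + (1 + q a b).arg := rfl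

theorem mul_r (a b : SU11Cover) : (a * b).r = ‖a.z * b.z + a.w * (starRingEnd ℂ) b.w‖ := rfl

theorem mul_z (a b : SU11Cover) : (a * b).z = a.z * b.z + a.w * (starRingEnd ℂ) b.w := by
  have h : (a * b).r = a.r * b.r * ‖1 + q a b‖ := by
    rw [mul_r, ← mul_one_add_q, norm_mul, norm_mul, norm_z, norm_z]
  rw [← mul_one_add_q, z, h, mul_φ]
  conv_rhs => rw [← Complex.norm_mul_exp_arg_mul_I (1 + q a b)]
  simp only [z]
  push_cast
  rw [add_mul, add_mul, Complex.exp_add, Complex.exp_add]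
  ring

@[simp] theorem one_w : (1 : SU11Cover).w = 0 := rfl
@[simp] theorem one_φ : (1 : SU11Cover).φ = 0 := rfl
@[simp] theorem one_r : (1 : SU11Cover).r = 1 := rfl
@[simp] theorem one_z : (1 : SU11Cover).z = 1 := by simp [z]
@[simp] theorem inv_w (a : SU11Cover) : (a⁻¹).w = -a.w := rfl
@[simp] theorem inv_φ (a : SU11Cover) : (a⁻¹).φ = -a.φ := rfl
@[simp] theorem inv_r (a : SU11Cover) : (a⁻¹).r = a.r := rfl

@[simp] theorem inv_z (a : SU11Cover) : (a⁻¹).z = (starRingEnd ℂ) a.z := by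
  simp [z, ← Complex.exp_conj]

theorem ext_of_abs_lt {a b : SU11Cover} (hw : a.w = b.w) (hz : a.z = b.z)
    (hφ : |a.φ - b.φ| < 2 * Real.pi) : a = b := by
  have hr : a.r = b.r := by rw [← norm_z, ← norm_z, hz]
  refine SU11Cover.ext hw ?_ hr
  rw [z, z, hr] at hz
  have hb : (b.r : ℂ) ≠ 0 := by exact_mod_cast b.r_pos.ne'
  obtain ⟨n, hn⟩ := Complex.exp_eq_exp_iff_exists_int.1 (mul_left_cancel₀ hb hz)
  have hn' : a.φ = b.φ + n * (2 * Real.pi) := by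
    have := congrArg Complex.im hn
    simpa using this
  have h0 : n = 0 := by
    rw [hn', add_sub_cancel_left, abs_mul, abs_of_pos Real.two_pi_pos] at hφ
    have h1 : |(n : ℝ)| < 1 := by
      by_contra! h
      nlinarith [Real.two_pi_pos]
    exact Int.abs_lt_one_iff.1 (by exact_mod_cast h1)
  simpa [h0] using hn'

theorem abs_arg_lt (a b : SU11Cover) : |(1 + q a b).arg| < Real.pi / 2 :=
  Complex.abs_arg_lt_pi_div_two_iff.2 (Or.inl (re_one_add_q_pos a b))

noncomputable instance : Group SU11Cover where
  mul_assoc a b c := by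
    refine ext_of_abs_lt ?_ ?_ ?_
    · simp only [mul_w, mul_z, map_add, map_mul, Complex.conj_conj]; ring
    · simp only [mul_w, mul_z, map_add, map_mul, Complex.conj_conj]; ring
    · have h1 := abs_lt.1 (abs_arg_lt a b)
      have h2 := abs_lt.1 (abs_arg_lt (a * b) c)
      have h3 := abs_lt.1 (abs_arg_lt b c)
      have h4 := abs_lt.1 (abs_arg_lt a (b * c))
      simp only [mul_φ]
      rw [abs_lt]
      constructor <;> linarith [h1.1, h1.2, h2.1, h2.2, h3.1, h3.2, h4.1, h4.2]
  one_mul a := by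
    refine ext_of_abs_lt ?_ ?_ ?_
    · simp [mul_w]
    · simp [mul_z]
    · simp [mul_φ, q, Real.pi_pos]
  mul_one a := by
    refine ext_of_abs_lt ?_ ?_ ?_
    · simp [mul_w]
    · simp [mul_z]
    · simp [mul_φ, q, Real.pi_pos]
  inv_mul_cancel a := by
    refine ext_of_abs_lt ?_ ?_ ?_
    · simp only [mul_w, inv_w, inv_z, one_w]; ring
    · simp only [mul_z, inv_w, inv_z, one_z]
      linear_combination a.det_eq
    · have h1 := abs_lt.1 (abs_arg_lt a⁻¹ a)
      simp only [mul_φ, inv_φ, one_φ]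
      rw [abs_lt]
      constructor <;> linarith [h1.1, h1.2, Real.pi_pos]

/-- The matrix of `SU(1,1)` below a point of the cover. -/
noncomputable def toMatrix (a : SU11Cover) : Matrix.SpecialLinearGroup (Fin 2) ℂ :=
  ⟨!![a.z, a.w; (starRingEnd ℂ) a.w, (starRingEnd ℂ) a.z], by
    rw [Matrix.det_fin_two_of]; exact a.det_eq⟩

/-- The covering homomorphism `(w, φ, r) ↦ (r e^{iφ}, w)` onto `SU(1,1)`. -/
noncomputable def toSU11 : SU11Cover →* SU11 where
  toFun a := ⟨a.toMatrix, rfl, rfl⟩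
  map_one' := by
    ext i j; fin_cases i <;> fin_cases j <;> simp [toMatrix]
  map_mul' a b := by
    refine Subtype.ext (Subtype.ext ?_)
    change (a * b).toMatrix.1 = a.toMatrix.1 * b.toMatrix.1
    ext i j
    fin_cases i <;> fin_cases j <;>
      simp [toMatrix, mul_z, mul_w, Matrix.mul_apply, Fin.sum_univ_two] <;> ring

theorem toSU11_surjective : Function.Surjective toSU11 := by
  rintro ⟨A, hA, hA'⟩
  have hd : Complex.normSq (A 0 0) - Complex.normSq (A 0 1) = 1 := by
    have h := A.det_coe
    rw [Matrix.det_fin_two, hA, hA', Complex.mul_conj, Complex.mul_conj] at h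
    exact_mod_cast h
  rw [Complex.normSq_eq_norm_sq, Complex.normSq_eq_norm_sq] at hd
  have h0 : 0 < ‖A 0 0‖ := by
    rw [norm_pos_iff]; intro h; rw [h] at hd; norm_num at hd; nlinarith [sq_nonneg ‖A 0 1‖]
  refine ⟨⟨A 0 1, (A 0 0).arg, ‖A 0 0‖, h0, by linarith⟩, ?_⟩
  have hz : (‖A 0 0‖ : ℂ) * Complex.exp ((A 0 0).arg * Complex.I) = A 0 0 :=
    Complex.norm_mul_exp_arg_mul_I _
  refine Subtype.ext (Subtype.ext ?_)
  ext i j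
  fin_cases i <;> fin_cases j
  · exact hz
  · rfl
  · exact hA.symm
  · exact (congrArg (starRingEnd ℂ) hz).trans hA'.symm

/-- The topology of the cover is that of a subspace of `ℂ × ℝ × ℝ`. -/
noncomputable instance : TopologicalSpace SU11Cover :=
  TopologicalSpace.induced (fun a => (a.w, a.φ, a.r)) inferInstance

/-- Forgetting the coordinate `r` is a homeomorphism onto `ℂ × ℝ`. -/
noncomputable def homeoProd : SU11Cover ≃ₜ ℂ × ℝ where
  toFun a := (a.w, a.φ)
  invFun p := ⟨p.1, p.2, √(1 + ‖p.1‖ ^ 2), by positivity, by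
    rw [Real.sq_sqrt (by positivity)]; ring⟩
  left_inv a := by
    refine SU11Cover.ext rfl rfl ?_
    simp only [a.norm_w_sq]
    rw [add_sub_cancel, Real.sqrt_sq a.r_pos.le]
  right_inv p := rfl
  continuous_toFun := by
    have h : Continuous fun a : SU11Cover => (a.w, a.φ, a.r) := continuous_induced_dom
    exact h.fst.prodMk h.snd.fst
  continuous_invFun := by
    refine continuous_induced_rng.2 ?_
    simp only [Function.comp_def]
    fun_prop

instance : SimplyConnectedSpace SU11Cover :=
  haveI : ContractibleSpace SU11Cover := homeoProd.contractibleSpace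
  inferInstance

theorem continuous_w : Continuous (fun a : SU11Cover => a.w) :=
  (continuous_induced_dom (f := fun a : SU11Cover => (a.w, a.φ, a.r))).fst

theorem continuous_φ : Continuous (fun a : SU11Cover => a.φ) :=
  (continuous_induced_dom (f := fun a : SU11Cover => (a.w, a.φ, a.r))).snd.fst

theorem continuous_r : Continuous (fun a : SU11Cover => a.r) :=
  (continuous_induced_dom (f := fun a : SU11Cover => (a.w, a.φ, a.r))).snd.snd

theorem continuous_z : Continuous z := by
  have := continuous_φ
  have := continuous_r
  unfold z
  fun_prop

instance : IsTopologicalGroup SU11Cover where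
  continuous_mul := by
    have hw := continuous_w
    have hφ := continuous_φ
    have hz := continuous_z
    have hq : Continuous fun p : SU11Cover × SU11Cover => 1 + q p.1 p.2 := by
      unfold q
      refine continuous_const.add (Continuous.div (by fun_prop) (by fun_prop) fun p => ?_)
      exact mul_ne_zero p.1.z_ne_zero p.2.z_ne_zero
    refine continuous_induced_rng.2 ?_
    simp only [Function.comp_def, mul_w, mul_φ, mul_r]
    refine Continuous.prodMk (by fun_prop) (Continuous.prodMk ?_ (by fun_prop))
    refine Continuous.add (by fun_prop) ?_
    exact continuous_iff_continuousAt.2 fun p =>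
      ContinuousAt.comp (f := fun p : SU11Cover × SU11Cover => 1 + q p.1 p.2)
        (Complex.continuousAt_arg (Or.inl (re_one_add_q_pos p.1 p.2))) hq.continuousAt
  continuous_inv := by
    have hw := continuous_w
    have hφ := continuous_φ
    have hr := continuous_r
    refine continuous_induced_rng.2 ?_
    simp only [Function.comp_def, inv_w, inv_φ, inv_r]
    fun_prop

theorem continuous_toSU11 : Continuous toSU11 := by
  have hw := continuous_w
  have hz := continuous_z
  refine Continuous.subtype_mk (Continuous.subtype_mk ?_ _) _
  refine continuous_matrix fun i j => ?_
  fin_cases i <;> fin_cases j <;> simp <;> fun_prop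

theorem isOpenMap_toSU11 : IsOpenMap toSU11 := by
  have hne : ∀ A : SU11, (A : Matrix.SpecialLinearGroup (Fin 2) ℂ) 0 0 ≠ 0 := fun A => by
    obtain ⟨a, rfl⟩ := toSU11_surjective A
    exact a.z_ne_zero
  let k : SU11 → ℂ × Circle := fun A =>
    ((A : Matrix.SpecialLinearGroup (Fin 2) ℂ) 0 1,
      ⟨(A : Matrix.SpecialLinearGroup (Fin 2) ℂ) 0 0 /
        ‖(A : Matrix.SpecialLinearGroup (Fin 2) ℂ) 0 0‖, by
        simp [Submonoid.unitSphere, norm_ne_zero_iff.2 (hne A)]⟩)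
  have hval : Continuous fun A : SU11 => (A.1.1 : Matrix (Fin 2) (Fin 2) ℂ) :=
    Continuous.comp (g := fun B : Matrix.SpecialLinearGroup (Fin 2) ℂ => B.1)
      continuous_subtype_val continuous_subtype_val
  have hent : ∀ i j, Continuous fun A : SU11 =>
      (A : Matrix.SpecialLinearGroup (Fin 2) ℂ) i j := fun i j => hval.matrix_elem i j
  have hk : Continuous k := by
    refine (hent 0 1).prodMk (Continuous.subtype_mk ?_ _)
    refine (hent 0 0).div (Complex.continuous_ofReal.comp (hent 0 0).norm) fun A => ?_
    exact_mod_cast norm_ne_zero_iff.2 (hne A)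
  have hkf : ∀ a, k (toSU11 a) = Prod.map id Circle.exp (homeoProd a) := fun a => by
    refine Prod.ext rfl (Subtype.ext ?_)
    have : (a.r : ℂ) ≠ 0 := by exact_mod_cast a.r_pos.ne'
    change a.z / (‖a.z‖ : ℂ) = Complex.exp (a.φ * Complex.I)
    rw [norm_z, z]
    field_simp
  have hinj : Function.Injective k := by
    intro A B h
    obtain ⟨a, rfl⟩ := toSU11_surjective A
    obtain ⟨b, rfl⟩ := toSU11_surjective B
    have hw : a.w = b.w := congrArg Prod.fst h
    have hr : a.r = b.r := by
      have h1 := a.norm_w_sq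
      rw [hw, b.norm_w_sq] at h1
      nlinarith [a.r_pos, b.r_pos]
    have hu : a.z / (‖a.z‖ : ℂ) = b.z / (‖b.z‖ : ℂ) := congrArg (fun p => (p.2 : ℂ)) h
    have hb : (b.r : ℂ) ≠ 0 := by exact_mod_cast b.r_pos.ne'
    have hz : a.z = b.z := by
      rw [norm_z, norm_z, hr] at hu
      exact (div_left_inj' hb).1 hu
    refine Subtype.ext (Subtype.ext ?_)
    change (!![a.z, a.w; (starRingEnd ℂ) a.w, (starRingEnd ℂ) a.z] : Matrix (Fin 2) (Fin 2) ℂ) =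
      !![b.z, b.w; (starRingEnd ℂ) b.w, (starRingEnd ℂ) b.z]
    rw [hw, hz]
  intro U hU
  have hopen : IsOpen (k '' (toSU11 '' U)) := by
    have : k '' (toSU11 '' U) = Prod.map id Circle.exp '' (homeoProd '' U) := by
      rw [Set.image_image, Set.image_image]
      exact Set.image_congr fun a _ => hkf a
    rw [this]
    exact (IsOpenMap.id.prodMap Circle.isCoveringMap_exp.isOpenMap) _ (homeoProd.isOpenMap _ hU)
  rw [← hinj.preimage_image (toSU11 '' U)]
  exact hopen.preimage hk

/-- Together with the simple connectedness of `SU11Cover` this says that `toSU11` is the universal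
covering of `SU(1,1)`. -/
theorem isCoveringMap_toSU11 : IsCoveringMap toSU11 := by
  have hq : Topology.IsQuotientMap toSU11 :=
    isOpenMap_toSU11.isQuotientMap continuous_toSU11 toSU11_surjective
  refine (hq.isQuotientCoveringMap_of_isDiscrete_ker_monoidHom ?_).isCoveringMap
  have : DiscreteTopology toSU11.ker := by
    refine discreteTopology_of_isOpen_singleton_one ?_
    have ho : IsOpen {a : SU11Cover | |a.φ| < 2 * Real.pi} :=
      isOpen_lt continuous_φ.abs continuous_const
    convert! ho.preimage (continuous_subtype_val : Continuous (Subtype.val : toSU11.ker → _))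
    ext ⟨a, ha⟩
    have hM : toSU11 a = 1 := ha
    constructor
    · intro h
      have : a = 1 := congrArg Subtype.val (Set.mem_singleton_iff.1 h)
      simp [this, Real.pi_pos]
    · intro h
      have hw : a.w = 0 := by
        have := congrArg (fun A : SU11 => (A : Matrix.SpecialLinearGroup (Fin 2) ℂ) 0 1) hM
        simpa [toSU11, toMatrix] using this
      have hz : a.z = 1 := by
        have := congrArg (fun A : SU11 => (A : Matrix.SpecialLinearGroup (Fin 2) ℂ) 0 0) hM
        simpa [toSU11, toMatrix] using this
      refine Set.mem_singleton_iff.2 (Subtype.ext (ext_of_abs_lt hw ?_ ?_))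
      · rw [hz]; exact one_z.symm
      · change |a.φ - 0| < _
        rw [sub_zero]; exact h
  exact ⟨this⟩

end SU11Cover

/-- The relators of the group with generators `c` (the letter `none`) and `γ₁, …, γₙ` (the letters
`some i`) and with relations `γᵢ c = c γᵢ`, `γᵢ ^ eᵢ = c` and `γ₁ ⋯ γₙ = c ^ (n - 2)`. -/
def fuchsianRelators {n : ℕ} (e : Fin n → ℕ) : Set (FreeGroup (Option (Fin n))) :=
  {x | ∃ i, x = FreeGroup.of (some i) * FreeGroup.of none *
      (FreeGroup.of (some i))⁻¹ * (FreeGroup.of none)⁻¹} ∪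
  {x | ∃ i, x = FreeGroup.of (some i) ^ e i * (FreeGroup.of none)⁻¹} ∪
  {(List.ofFn fun i => FreeGroup.of (some i)).prod * (FreeGroup.of none ^ ((n : ℤ) - 2))⁻¹}

/-- The elements `γ₁, …, γₙ, c` generate the group `P`, with `fuchsianRelators e` as defining
relators: the relations between them are exactly the consequences of these relators. -/
structure IsStandardGenerators {P : Type*} [Group P] {n : ℕ} (e : Fin n → ℕ) (γ : Fin n → P)
    (c : P) : Prop where
  closure_eq_top : Subgroup.closure (insert c (Set.range γ)) = ⊤
  ker_eq : (FreeGroup.lift fun x : Option (Fin n) => x.elim c γ).ker =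
    Subgroup.normalClosure (fuchsianRelators e)

/-! The universal cover of `SU(1,1)` acts faithfully on the real line by increasing maps (lifted
directions in `ℂ`). An increasing map has no periodic points other than fixed points, so the cover
and its subgroup `P` are torsion free. Two consequences follow. The central element `c` has infinite
order, so each `γ i` has order exactly `e i` in `Q = P / ⟨c⟩`; and `Q` is infinite, since a torsion
free group with centre of finite index is abelian (`mul_comm_of_finiteIndex_center`), whereas `g` is
not central.

By the presentation, `Q` is given by `γᵢ ^ eᵢ = 1` and `γ₁ ⋯ γₙ = 1`. Geometrically `Q` acts on a
plane tessellated as follows: vertices `Q` and the cosets `Q / ⟨γᵢ⟩`, an edge of type `i` from each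
`q` to `q⟨γᵢ⟩`, and 2-cells indexed by `Q`, the boundary of the basic cell having edge components
`pᵢ (γᵢ - 1)` with `pᵢ = γ₁ ⋯ γᵢ₋₁`. Only the cellular chains over `ℤ[Q]` are used: Fox calculus
gives exactness in degree one (`exists_eq_boundary`), and infiniteness of `Q` gives it in degree two
(`eq_zero_of_boundary_eq_zero`).

On such an acyclic complex an element of prime order `p` fixes exactly one vertex, as in Smith
theory: a diagram chase using the vanishing Tate cohomology of free modules turns either failure
into `p ∣ 1` (`exists_conj_mem_of_prime`, `eq_of_conj_mem_of_prime`). Fixing `x⟨γᵢ⟩` means being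
conjugate by `x` into `⟨γᵢ⟩`. Passing to powers of prime order, every nontrivial torsion element of
`Q` fixes exactly one coset; hence `Q` has trivial centre, `Z(P) = ⟨c⟩`, and lifting to `P` gives
the triple and its uniqueness. -/

namespace SU11Cover

/-! ### Action of the cover on the line, and absence of torsion -/

/-- The real linear action of the matrix below `a` on `ℂ`. -/
noncomputable def act (a : SU11Cover) (u : ℂ) : ℂ := a.z * u + a.w * (starRingEnd ℂ) u

theorem act_mul (a b : SU11Cover) (u : ℂ) : (a * b).act u = a.act (b.act u) := by
  simp only [act, mul_z, mul_w, map_add, map_mul, Complex.conj_conj]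
  ring

theorem act_real_mul (a : SU11Cover) (s : ℝ) (u : ℂ) : a.act (s * u) = s * a.act u := by
  simp only [act, map_mul, Complex.conj_ofReal]
  ring

/-- The ratio of the two summands of `a.act (exp (t * I))`. -/
noncomputable def ratio (a : SU11Cover) (t : ℝ) : ℂ :=
  a.w / a.z * Complex.exp ((-2 * t : ℝ) * Complex.I)

theorem norm_ratio_lt (a : SU11Cover) (t : ℝ) : ‖a.ratio t‖ < 1 := by
  rw [ratio, norm_mul, Complex.norm_exp_ofReal_mul_I, mul_one, norm_div,
    div_lt_one (norm_pos_iff.2 a.z_ne_zero)]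
  exact a.norm_w_lt

theorem re_one_add_ratio_pos (a : SU11Cover) (t : ℝ) : 0 < (1 + a.ratio t).re := by
  have h := (abs_lt.1 ((Complex.abs_re_le_norm _).trans_lt (norm_ratio_lt a t))).1
  simp only [Complex.add_re, Complex.one_re]
  linarith

/-- The lift to `ℝ` of the action on directions in `ℂ`. -/
noncomputable def lineAct (a : SU11Cover) (t : ℝ) : ℝ := t + a.φ + (1 + a.ratio t).arg

theorem abs_arg_ratio_lt (a : SU11Cover) (t : ℝ) : |(1 + a.ratio t).arg| < Real.pi / 2 :=
  Complex.abs_arg_lt_pi_div_two_iff.2 (Or.inl (re_one_add_ratio_pos a t))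

theorem act_exp (a : SU11Cover) (t : ℝ) : ∃ R : ℝ, 0 < R ∧
    a.act (Complex.exp (t * Complex.I)) = R * Complex.exp (a.lineAct t * Complex.I) := by
  refine ⟨a.r * ‖1 + a.ratio t‖, mul_pos a.r_pos (norm_pos_iff.2 fun h => ?_), ?_⟩
  · have := re_one_add_ratio_pos a t
    simp [h] at this
  · have h1 : a.act (Complex.exp (t * Complex.I)) =
        a.z * Complex.exp (t * Complex.I) * (1 + a.ratio t) := by
      have hz := a.z_ne_zero
      have he : Complex.exp ((-2 * t : ℝ) * Complex.I) * Complex.exp (t * Complex.I) =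
          (starRingEnd ℂ) (Complex.exp (t * Complex.I)) := by
        rw [← Complex.exp_add, ← Complex.exp_conj]
        congr 1
        simp
        ring
      rw [act, ← he, ratio]
      field_simp
    rw [h1]
    conv_lhs => rw [← Complex.norm_mul_exp_arg_mul_I (1 + a.ratio t)]
    simp only [z, lineAct]
    push_cast
    rw [add_mul, add_mul, Complex.exp_add, Complex.exp_add]
    ring

theorem eq_of_exp_eq {x y R S : ℝ} (hR : 0 < R) (hS : 0 < S) (hxy : |x - y| < 2 * Real.pi)
    (h : (R : ℂ) * Complex.exp (x * Complex.I) = S * Complex.exp (y * Complex.I)) : x = y := by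
  have hRS : R = S := by
    have := congrArg norm h
    simpa [Complex.norm_exp_ofReal_mul_I, abs_of_pos hR, abs_of_pos hS] using this
  subst hRS
  have hb : (R : ℂ) ≠ 0 := by exact_mod_cast hR.ne'
  obtain ⟨n, hn⟩ := Complex.exp_eq_exp_iff_exists_int.1 (mul_left_cancel₀ hb h)
  have hn' : x = y + n * (2 * Real.pi) := by
    have := congrArg Complex.im hn
    simpa using this
  have h0 : n = 0 := by
    rw [hn', add_sub_cancel_left, abs_mul, abs_of_pos Real.two_pi_pos] at hxy
    have h1 : |(n : ℝ)| < 1 := by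
      by_contra! h
      nlinarith [Real.two_pi_pos]
    exact Int.abs_lt_one_iff.1 (by exact_mod_cast h1)
  simpa [h0] using hn'

/-- Both sides lift the same direction, so they differ by a multiple of `2π`; the four arguments
involved are each below `π / 2` in absolute value, so that multiple is zero. -/
theorem lineAct_mul (a b : SU11Cover) (t : ℝ) : (a * b).lineAct t = a.lineAct (b.lineAct t) := by
  obtain ⟨R, hR, h⟩ := (a * b).act_exp t
  obtain ⟨S, hS, h'⟩ := b.act_exp t
  obtain ⟨T, hT, h''⟩ := a.act_exp (b.lineAct t)
  rw [act_mul, h', act_real_mul, h'', ← mul_assoc, ← Complex.ofReal_mul] at h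
  refine (eq_of_exp_eq (mul_pos hS hT) hR ?_ h).symm
  have h1 := abs_lt.1 (abs_arg_lt a b)
  have h2 := abs_lt.1 ((a * b).abs_arg_ratio_lt t)
  have h3 := abs_lt.1 (b.abs_arg_ratio_lt t)
  have h4 := abs_lt.1 (a.abs_arg_ratio_lt (b.lineAct t))
  simp only [lineAct] at h4 ⊢
  simp only [mul_φ]
  rw [abs_lt]
  constructor <;> linarith [h1.1, h1.2, h2.1, h2.2, h3.1, h3.2, h4.1, h4.2]

theorem lineAct_one (t : ℝ) : (1 : SU11Cover).lineAct t = t := by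
  simp [lineAct, ratio]

theorem continuous_lineAct (a : SU11Cover) : Continuous a.lineAct := by
  have h : Continuous fun t : ℝ => 1 + a.ratio t := by
    unfold ratio
    fun_prop
  refine (continuous_id.add continuous_const).add (continuous_iff_continuousAt.2 fun t => ?_)
  exact ContinuousAt.comp (f := fun t : ℝ => 1 + a.ratio t)
    (Complex.continuousAt_arg (Or.inl (re_one_add_ratio_pos a t))) h.continuousAt

theorem lineAct_add_pi (a : SU11Cover) (t : ℝ) :
    a.lineAct (t + Real.pi) = a.lineAct t + Real.pi := by
  have : a.ratio (t + Real.pi) = a.ratio t := by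
    rw [ratio, ratio]
    congr 1
    refine Complex.exp_eq_exp_iff_exists_int.2 ⟨-1, ?_⟩
    push_cast
    ring
  rw [lineAct, lineAct, this]
  ring

theorem lineAct_injective (a : SU11Cover) : Function.Injective a.lineAct :=
  Function.LeftInverse.injective (g := a⁻¹.lineAct) fun t => by
    rw [← lineAct_mul, inv_mul_cancel, lineAct_one]

/-- A continuous injection of the line is monotone or antitone; commuting with translation by `π`
excludes the latter. -/
theorem strictMono_lineAct (a : SU11Cover) : StrictMono a.lineAct := by
  refine (a.continuous_lineAct.strictMono_of_inj a.lineAct_injective).resolve_right fun h => ?_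
  have h1 := h (show (0 : ℝ) < 0 + Real.pi by linarith [Real.pi_pos])
  rw [lineAct_add_pi] at h1
  linarith [Real.pi_pos]

theorem lineAct_pow (a : SU11Cover) (k : ℕ) (t : ℝ) : (a ^ k).lineAct t = a.lineAct^[k] t := by
  induction k with
  | zero => simp [lineAct_one]
  | succ k ih => rw [pow_succ', lineAct_mul, ih, Function.iterate_succ_apply']

/-- Faithfulness: every direction is an eigendirection, and the three directions `1`, `I`, `1 + I`
already force `w = 0`. Then `lineAct` is translation by `φ`. -/
theorem eq_one_of_lineAct_eq (a : SU11Cover) (h : ∀ t, a.lineAct t = t) : a = 1 := by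
  have key : ∀ t : ℝ, ∃ R : ℝ, a.act (Complex.exp (t * Complex.I)) =
      R * Complex.exp (t * Complex.I) := fun t => by
    obtain ⟨R, -, hR⟩ := a.act_exp t
    exact ⟨R, by rw [hR, h]⟩
  have hw : a.w = 0 := by
    obtain ⟨R, hR⟩ := key 0
    obtain ⟨S, hS⟩ := key (Real.pi / 2)
    obtain ⟨T, hT⟩ := key (Real.pi / 4)
    have h2 : Complex.exp ((Real.pi / 2 : ℝ) * Complex.I) = Complex.I := by
      push_cast
      exact Complex.exp_pi_div_two_mul_I
    have h4 : Complex.exp ((Real.pi / 4 : ℝ) * Complex.I) = (√2 / 2 : ℝ) * (1 + Complex.I) := by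
      rw [Complex.exp_mul_I, ← Complex.ofReal_cos, ← Complex.ofReal_sin, Real.cos_pi_div_four,
        Real.sin_pi_div_four]
      ring
    have hs : (√2 / 2 : ℝ) ≠ 0 := by positivity
    rw [h2] at hS
    rw [h4, act_real_mul, mul_left_comm] at hT
    replace hT := mul_left_cancel₀ (Complex.ofReal_ne_zero.2 hs) hT
    simp only [act, Complex.ext_iff] at hR hS hT
    simp at hR hS hT
    apply Complex.ext <;> simp <;> linarith [hR.1, hR.2, hS.1, hS.2, hT.1, hT.2]
  have hφ : a.φ = 0 := by
    have := h 0
    simpa [lineAct, ratio, hw] using this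
  refine ext_of_abs_lt hw ?_ (by simp [hφ, Real.pi_pos])
  have hr : a.r = 1 := by
    have := a.norm_w_sq
    rw [hw, norm_zero] at this
    nlinarith [a.r_pos]
  simp [z, hr, hφ]

/-- The universal cover of `SU(1,1)` is torsion free. -/
theorem eq_one_of_pow_eq_one {a : SU11Cover} {m : ℕ} (hm : m ≠ 0) (h : a ^ m = 1) : a = 1 := by
  refine eq_one_of_lineAct_eq a fun t => ?_
  have hfix : a.lineAct^[m] t = t := by rw [← lineAct_pow, h, lineAct_one]
  -- Under an increasing map, the orbit of a point that moves is strictly monotone and never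
  -- returns.
  rcases lt_trichotomy (a.lineAct t) t with hlt | heq | hgt
  · have := a.strictMono_lineAct.strictAnti_iterate_of_map_lt hlt (Nat.pos_of_ne_zero hm)
    simp only [hfix, Function.iterate_zero, id_eq, lt_irrefl] at this
  · exact heq
  · have := a.strictMono_lineAct.strictMono_iterate_of_lt_map hgt (Nat.pos_of_ne_zero hm)
    simp only [hfix, Function.iterate_zero, id_eq, lt_irrefl] at this

end SU11Cover

/-! ### Vanishing of Tate cohomology from a local section -/

section PeriodicEndomorphism

variable {M : Type*} [AddCommGroup M] {T s : Module.End ℤ M} {m : ℕ}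

/-- The identity `hs` is a contracting homotopy for the cyclic group generated by `T`. On a fixed
vector it reads `x = ∑ T ^ j (s x)`. -/
theorem exists_eq_norm_of_fixed
    (hs : ∑ j ∈ Finset.range m, T ^ j * s * T ^ (m - j) = 1) {x : M} (hx : T x = x) :
    ∃ y, x = (∑ j ∈ Finset.range m, T ^ j) y := by
  refine ⟨s x, ?_⟩
  have hfix : ∀ k : ℕ, (T ^ k) x = x := fun k => by
    induction k with
    | zero => simp
    | succ k ih => rw [pow_succ, Module.End.mul_apply, hx, ih]
  have := congrArg (fun A : Module.End ℤ M => A x) hs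
  simpa [LinearMap.sum_apply, hfix] using this.symm

theorem exists_eq_sub_of_norm_eq_zero (hm : T ^ m = 1)
    (hs : ∑ j ∈ Finset.range m, T ^ j * s * T ^ (m - j) = 1) {x : M}
    (hx : (∑ j ∈ Finset.range m, T ^ j) x = 0) : ∃ y, x = T y - y := by
  have hsum : ∑ j ∈ Finset.range m, T ^ (m - j) = ∑ j ∈ Finset.range m, T ^ j := by
    have h := Finset.sum_range_succ (fun j => T ^ j) m
    rw [Finset.sum_range_succ', hm, pow_zero] at h
    rw [← add_right_cancel h, ← Finset.sum_range_reflect]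
    refine Finset.sum_congr rfl fun j hj => ?_
    congr 1
    have := Finset.mem_range.1 hj
    omega
  -- Subtracting `s * ∑ T ^ (m - j)` from `hs` leaves terms `(T ^ j - 1) * s * T ^ (m - j)`, each
  -- divisible by `T - 1` on the left.
  have hT : ∑ j ∈ Finset.range m, (T - 1) * ((∑ i ∈ Finset.range j, T ^ i) * s * T ^ (m - j)) =
      1 - s * ∑ j ∈ Finset.range m, T ^ j := by
    conv_rhs => rw [← hs]
    rw [← hsum, Finset.mul_sum, ← Finset.sum_sub_distrib]
    refine Finset.sum_congr rfl fun j _ => ?_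
    rw [← mul_assoc, ← mul_assoc, mul_geom_sum, sub_mul, sub_mul, one_mul]
  rw [← Finset.mul_sum] at hT
  refine ⟨(∑ j ∈ Finset.range m, (∑ i ∈ Finset.range j, T ^ i) * s * T ^ (m - j)) x, ?_⟩
  have := congrArg (fun A : Module.End ℤ M => A x) hT
  simp only [Module.End.mul_apply, LinearMap.sub_apply, Module.End.one_apply, hx, map_zero,
    sub_zero] at this
  exact this.symm

end PeriodicEndomorphism

/-! ### Finitely supported functions under a free permutation -/

section FreePerm

variable {X : Type*} {σ : Equiv.Perm X} {m : ℕ}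

/-- The indicator function of a transversal for the orbits of a freely acting permutation. -/
theorem exists_transversal_indicator (hm0 : 0 < m) (hm : σ ^ m = 1)
    (hfree : ∀ j, 0 < j → j < m → ∀ x, (σ ^ j) x ≠ x) :
    ∃ s : X → ℤ, ∀ x, ∑ j ∈ Finset.range m, s ((σ ^ j) x) = 1 := by
  classical
  let r : X → X := fun x => (Quotient.mk (Equiv.Perm.SameCycle.setoid σ) x).out
  have hr : ∀ x (j : ℕ), r ((σ ^ j) x) = r x := fun x j => by
    refine congrArg Quotient.out (Quotient.sound ?_)
    exact (Equiv.Perm.sameCycle_pow_left (n := j)).2 (Equiv.Perm.SameCycle.refl σ x)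
  have hout : ∀ x, σ.SameCycle x (r x) := fun x =>
    (Quotient.exact (Quotient.out_eq (Quotient.mk (Equiv.Perm.SameCycle.setoid σ) x)) :
      σ.SameCycle (r x) x).symm
  refine ⟨fun x => if x = r x then 1 else 0, fun x => ?_⟩
  simp only [hr]
  obtain ⟨k, hk⟩ := hout x
  have hm0' : (m : ℤ) ≠ 0 := by exact_mod_cast hm0.ne'
  obtain ⟨j, hj⟩ := Int.eq_ofNat_of_zero_le (Int.emod_nonneg k hm0')
  have hjm : j < m := by
    have := Int.emod_lt_of_pos k (by exact_mod_cast hm0 : (0 : ℤ) < m)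
    omega
  have hjx : (σ ^ j) x = r x := by
    rw [← hk]
    have : σ ^ k = σ ^ (k % m) := by
      conv_lhs => rw [← Int.emod_add_mul_ediv k m, zpow_add, zpow_mul, zpow_natCast, hm, one_zpow,
        mul_one]
    rw [this, hj, zpow_natCast]
  -- By freeness, exactly one of the first `m` iterates of `x` is the chosen representative of its
  -- orbit.
  rw [Finset.sum_eq_single j]
  · simp [hjx]
  · intro i hi hij
    rw [if_neg]
    intro h
    rw [← hjx] at h
    have him := Finset.mem_range.1 hi
    rcases lt_or_gt_of_ne hij with hlt | hlt
    · refine hfree (j - i) (by omega) (by omega) ((σ ^ i) x) ?_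
      rw [← Equiv.Perm.mul_apply, ← pow_add, Nat.sub_add_cancel hlt.le, h]
    · refine hfree (i - j) (by omega) (by omega) ((σ ^ j) x) ?_
      rw [← Equiv.Perm.mul_apply, ← pow_add, Nat.sub_add_cancel hlt.le, h]
  · intro h
    exact absurd (Finset.mem_range.2 hjm) h

theorem lmapDomain_pow (σ : Equiv.Perm X) (j : ℕ) :
    (Finsupp.lmapDomain ℤ ℤ σ : Module.End ℤ (X →₀ ℤ)) ^ j = Finsupp.lmapDomain ℤ ℤ (σ ^ j) := by
  induction j with
  | zero => ext; simp
  | succ j ih =>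
    rw [pow_succ, ih, pow_succ, Equiv.Perm.coe_mul, Finsupp.lmapDomain_comp]
    rfl

/-- The map `s` multiplies by the indicator of a transversal; its conjugates by the powers of `σ`
restrict to the translates of the transversal, which partition `X`. -/
theorem exists_local_section (hm0 : 0 < m) (hm : σ ^ m = 1)
    (hfree : ∀ j, 0 < j → j < m → ∀ x, (σ ^ j) x ≠ x) :
    ∃ s : Module.End ℤ (X →₀ ℤ), ∑ j ∈ Finset.range m,
      (Finsupp.lmapDomain ℤ ℤ σ) ^ j * s * (Finsupp.lmapDomain ℤ ℤ σ) ^ (m - j) = 1 := by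
  obtain ⟨t, ht⟩ := exists_transversal_indicator hm0 hm hfree
  refine ⟨Finsupp.lsum ℤ fun x => t x • Finsupp.lsingle x, ?_⟩
  refine Finsupp.lhom_ext fun x b => ?_
  simp only [lmapDomain_pow, LinearMap.sum_apply, Module.End.mul_apply, Finsupp.lmapDomain_apply,
    Finsupp.mapDomain_single, Finsupp.lsum_single, LinearMap.smul_apply, Finsupp.lsingle_apply,
    Finsupp.mapDomain_smul, Module.End.one_apply]
  have h : ∀ j ∈ Finset.range m, (σ ^ j) ((σ ^ (m - j)) x) = x := fun j hj => by
    rw [← Equiv.Perm.mul_apply, ← pow_add, Nat.add_sub_cancel' (Finset.mem_range.1 hj).le, hm,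
      Equiv.Perm.one_apply]
  rw [Finset.sum_congr rfl fun j hj => by rw [h j hj], ← Finset.sum_smul]
  have h2 : ∑ j ∈ Finset.range m, t ((σ ^ (m - j)) x) = 1 := by
    rw [← ht (σ x), ← Finset.sum_range_reflect]
    refine Finset.sum_congr rfl fun j hj => ?_
    have := Finset.mem_range.1 hj
    rw [← Equiv.Perm.mul_apply, ← pow_succ]
    congr 3
    omega
  rw [h2, one_smul]

theorem exists_eq_sum_of_mapDomain_eq (hm0 : 0 < m) (hm : σ ^ m = 1)
    (hfree : ∀ j, 0 < j → j < m → ∀ x, (σ ^ j) x ≠ x) {f : X →₀ ℤ}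
    (hf : f.mapDomain σ = f) : ∃ f' : X →₀ ℤ,
      f = ∑ j ∈ Finset.range m, f'.mapDomain (σ ^ j : Equiv.Perm X) := by
  obtain ⟨s, hs⟩ := exists_local_section hm0 hm hfree
  obtain ⟨y, hy⟩ := exists_eq_norm_of_fixed hs
    (x := f) hf
  exact ⟨y, by simpa [LinearMap.sum_apply, lmapDomain_pow] using hy⟩

theorem exists_eq_sub_of_sum_mapDomain_eq_zero (hm0 : 0 < m) (hm : σ ^ m = 1)
    (hfree : ∀ j, 0 < j → j < m → ∀ x, (σ ^ j) x ≠ x) {f : X →₀ ℤ}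
    (hf : ∑ j ∈ Finset.range m, f.mapDomain (σ ^ j : Equiv.Perm X) = 0) :
    ∃ f' : X →₀ ℤ, f = f'.mapDomain σ - f' := by
  obtain ⟨s, hs⟩ := exists_local_section hm0 hm hfree
  exact exists_eq_sub_of_norm_eq_zero (by rw [lmapDomain_pow, hm]; ext; simp) hs
    (x := f) (by simpa [LinearMap.sum_apply, lmapDomain_pow] using hf)

/-- An invariant finitely supported function for a fixed point free permutation of prime order has
total mass divisible by the prime. -/
theorem dvd_sum_of_mapDomain_eq {p : ℕ} (hp : p.Prime) (hm : σ ^ p = 1) (hfix : ∀ x, σ x ≠ x)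
    {f : X →₀ ℤ} (hf : f.mapDomain σ = f) :
    (p : ℤ) ∣ Finsupp.linearCombination ℤ (fun _ : X => (1 : ℤ)) f := by
  have hfree : ∀ j, 0 < j → j < p → ∀ x, (σ ^ j) x ≠ x := fun j hj hjp x hx => by
    have hcop : Nat.Coprime j p := ((Nat.Prime.coprime_iff_not_dvd hp).2
      (Nat.not_dvd_of_pos_of_lt hj hjp)).symm
    have h1 : Function.IsPeriodicPt σ j x := by
      rw [Function.IsPeriodicPt, Function.IsFixedPt, ← Equiv.Perm.coe_pow, hx]
    have h2 : Function.IsPeriodicPt σ p x := by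
      rw [Function.IsPeriodicPt, Function.IsFixedPt, ← Equiv.Perm.coe_pow, hm]; rfl
    have := h1.gcd h2
    rw [hcop.gcd_eq_one] at this
    exact hfix x this
  -- All `p` translates of `f'` have the same total mass.
  obtain ⟨f', hf'⟩ := exists_eq_sum_of_mapDomain_eq hp.pos hm hfree hf
  rw [hf', map_sum]
  simp only [Finsupp.linearCombination_mapDomain]
  exact ⟨Finsupp.linearCombination ℤ (fun _ : X => (1 : ℤ)) f', by simp [Function.comp_def]⟩

end FreePerm

/-! ### Norm elements and the augmentation ideal of the group ring -/

section GroupRing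

variable {G : Type*} [Group G]

open MonoidAlgebra

theorem coeff_of_mul (g : G) (x : MonoidAlgebra ℤ G) :
    (of ℤ G g * x).coeff = x.coeff.mapDomain (Equiv.mulLeft g) := by
  ext a
  rw [Finsupp.mapDomain_equiv_apply]
  simp [of_apply]

theorem coeff_mul_of (g : G) (x : MonoidAlgebra ℤ G) :
    (x * of ℤ G g).coeff = x.coeff.mapDomain (Equiv.mulRight g) := by
  ext a
  rw [Finsupp.mapDomain_equiv_apply]
  simp [of_apply]

/-- The sum of the first `m` powers of `g` in the group ring. -/
noncomputable def powerSum (g : G) (m : ℕ) : MonoidAlgebra ℤ G :=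
  ∑ j ∈ Finset.range m, of ℤ G g ^ j

theorem powerSum_mul_sub {g : G} {m : ℕ} (hm : g ^ m = 1) :
    powerSum g m * (of ℤ G g - 1) = 0 := by
  rw [powerSum, geom_sum_mul, ← map_pow, hm, map_one, sub_self]

theorem sub_mul_powerSum {g : G} {m : ℕ} (hm : g ^ m = 1) :
    (of ℤ G g - 1) * powerSum g m = 0 := by
  rw [powerSum, mul_geom_sum, ← map_pow, hm, map_one, sub_self]

theorem mulLeft_pow_apply_ne {g : G} (j : ℕ) (hj : 0 < j) (hjo : j < orderOf g) (x : G) :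
    (Equiv.mulLeft g ^ j) x ≠ x := by
  rw [Equiv.pow_mulLeft, Equiv.coe_mulLeft, Ne, mul_eq_right]
  exact pow_ne_one_of_lt_orderOf hj.ne' hjo

theorem mulRight_pow_apply_ne {g : G} (j : ℕ) (hj : 0 < j) (hjo : j < orderOf g) (x : G) :
    (Equiv.mulRight g ^ j) x ≠ x := by
  rw [Equiv.pow_mulRight, Equiv.coe_mulRight, Ne, mul_eq_left]
  exact pow_ne_one_of_lt_orderOf hj.ne' hjo

theorem mulLeft_pow_orderOf (g : G) : Equiv.mulLeft g ^ orderOf g = 1 := by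
  rw [Equiv.pow_mulLeft, pow_orderOf_eq_one, Equiv.mulLeft_one]

theorem mulRight_pow_orderOf (g : G) : Equiv.mulRight g ^ orderOf g = 1 := by
  rw [Equiv.pow_mulRight, pow_orderOf_eq_one, Equiv.mulRight_one]

theorem exists_eq_powerSum_mul {g : G} (hg : 0 < orderOf g) {x : MonoidAlgebra ℤ G}
    (hx : (of ℤ G g - 1) * x = 0) : ∃ y, x = powerSum g (orderOf g) * y := by
  rw [sub_mul, one_mul, sub_eq_zero] at hx
  obtain ⟨y, hy⟩ := exists_eq_sum_of_mapDomain_eq hg (mulLeft_pow_orderOf g) mulLeft_pow_apply_ne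
    (f := x.coeff) (by rw [← coeff_of_mul, hx])
  refine ⟨ofCoeff y, coeff_injective ?_⟩
  rw [hy, powerSum, Finset.sum_mul, coeff_sum]
  refine Finset.sum_congr rfl fun j _ => ?_
  rw [← map_pow, coeff_of_mul, coeff_ofCoeff, Equiv.pow_mulLeft]

theorem exists_eq_sub_mul {g : G} (hg : 0 < orderOf g) {x : MonoidAlgebra ℤ G}
    (hx : powerSum g (orderOf g) * x = 0) : ∃ y, x = (of ℤ G g - 1) * y := by
  obtain ⟨y, hy⟩ := exists_eq_sub_of_sum_mapDomain_eq_zero hg (mulLeft_pow_orderOf g)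
    mulLeft_pow_apply_ne (f := x.coeff) (by
      have := congrArg coeff hx
      rw [powerSum, Finset.sum_mul, coeff_sum, coeff_zero] at this
      rw [← this]
      refine Finset.sum_congr rfl fun j _ => ?_
      rw [← map_pow, coeff_of_mul, Equiv.pow_mulLeft])
  refine ⟨ofCoeff y, coeff_injective ?_⟩
  rw [hy, sub_mul, one_mul, coeff_sub, coeff_of_mul]

theorem exists_eq_mul_sub {g : G} (hg : 0 < orderOf g) {x : MonoidAlgebra ℤ G}
    (hx : x * powerSum g (orderOf g) = 0) : ∃ y, x = y * (of ℤ G g - 1) := by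
  obtain ⟨y, hy⟩ := exists_eq_sub_of_sum_mapDomain_eq_zero hg (mulRight_pow_orderOf g)
    mulRight_pow_apply_ne (f := x.coeff) (by
      have := congrArg coeff hx
      rw [powerSum, Finset.mul_sum, coeff_sum, coeff_zero] at this
      rw [← this]
      refine Finset.sum_congr rfl fun j _ => ?_
      rw [← map_pow, coeff_mul_of, Equiv.pow_mulRight])
  refine ⟨ofCoeff y, coeff_injective ?_⟩
  rw [hy, mul_sub, mul_one, coeff_sub, coeff_mul_of]

/-- An invariant element has constant coefficients, and its support is finite. -/
theorem eq_zero_of_forall_mul_of_eq [Infinite G] {x : MonoidAlgebra ℤ G}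
    (hx : ∀ g, x * of ℤ G g = x) : x = 0 := by
  have hconst : ∀ g, x.coeff g = x.coeff 1 := fun g => by
    conv_lhs => rw [← hx g]
    simp [of_apply]
  obtain ⟨g, hg⟩ := Infinite.exists_notMem_finset x.coeff.support
  have h1 : x.coeff 1 = 0 := by rw [← hconst g]; simpa using hg
  refine coeff_injective (Finsupp.ext fun a => ?_)
  rw [hconst a, h1]; rfl

theorem of_sub_one_mem_span {ι : Type*} {γ : ι → G}
    (hgen : Subgroup.closure (Set.range γ) = ⊤) (g : G) :
    of ℤ G g - 1 ∈ Submodule.span (MonoidAlgebra ℤ G) (Set.range fun i => of ℤ G (γ i) - 1) := by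
  have hg : g ∈ Subgroup.closure (Set.range γ) := hgen ▸ Subgroup.mem_top g
  induction hg using Subgroup.closure_induction with
  | mem x hx =>
    obtain ⟨i, rfl⟩ := hx
    exact Submodule.subset_span ⟨i, rfl⟩
  | one => rw [map_one, sub_self]; exact zero_mem _
  | mul x y _ _ hx hy =>
    have : of ℤ G (x * y) - 1 = of ℤ G x • (of ℤ G y - 1) + (of ℤ G x - 1) := by
      rw [map_mul, smul_eq_mul, mul_sub, mul_one]; abel
    rw [this]
    exact add_mem (Submodule.smul_mem _ _ hy) hx
  | inv x _ hx =>
    have : of ℤ G x⁻¹ - 1 = -(of ℤ G x⁻¹ • (of ℤ G x - 1)) := by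
      rw [smul_eq_mul, mul_sub, ← map_mul, inv_mul_cancel, map_one, mul_one]; abel
    rw [this]
    exact neg_mem (Submodule.smul_mem _ _ hx)

/-- Connectedness of the complex: `y i * (γ i - 1)` are the edge components of a path from the base
vertex `1` to `g`. -/
theorem exists_of_sub_one_eq_sum {ι : Type*} [Fintype ι] {γ : ι → G}
    (hgen : Subgroup.closure (Set.range γ) = ⊤) (g : G) :
    ∃ y : ι → MonoidAlgebra ℤ G, of ℤ G g - 1 = ∑ i, y i * (of ℤ G (γ i) - 1) := by
  obtain ⟨y, hy⟩ := (Submodule.mem_span_range_iff_exists_fun _).1 (of_sub_one_mem_span hgen g)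
  exact ⟨y, hy.symm⟩

end GroupRing

/-! ### Polygon presentations and prefix products -/

/-- The group `G` is presented by the generators `γ i` of exact orders `e i` and the relation
`γ₁ ⋯ γₙ = 1`. -/
structure IsPolygonPresentation {G : Type} [Group G] {n : ℕ} (e : Fin n → ℕ) (γ : Fin n → G) :
    Prop where
  closure_eq_top : Subgroup.closure (Set.range γ) = ⊤
  pos : ∀ i, 0 < e i
  orderOf_eq : ∀ i, orderOf (γ i) = e i
  prod_eq : (List.ofFn γ).prod = 1
  exists_hom : ∀ (H : Type) [Group H] (f : Fin n → H), (∀ i, f i ^ e i = 1) →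
    (List.ofFn f).prod = 1 → ∃ φ : G →* H, ∀ i, φ (γ i) = f i

/-- The product of the first `k` entries. -/
def prefixProd {G : Type*} [Group G] {n : ℕ} (γ : Fin n → G) (k : ℕ) : G :=
  ((List.ofFn γ).take k).prod

section prefixProd

variable {G : Type*} [Group G] {n : ℕ} (γ : Fin n → G)

theorem prefixProd_zero : prefixProd γ 0 = 1 := by simp [prefixProd]

theorem prefixProd_succ (i : Fin n) :
    prefixProd γ (i + 1) = prefixProd γ i * γ i := by
  have h : (i : ℕ) < (List.ofFn γ).length := by simp
  rw [prefixProd, List.prod_take_succ _ _ h, prefixProd]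
  simp

theorem prefixProd_self : prefixProd γ n = (List.ofFn γ).prod := by
  rw [prefixProd, List.take_of_length_le (by simp)]

end prefixProd

/-! ### Affine permutations and Fox derivatives -/

section Affine

open MonoidAlgebra

variable {G : Type*} [Group G] {M : Type*} [AddCommGroup M] [Module (MonoidAlgebra ℤ G) M]

/-- The affine permutation `m ↦ g m + t`. -/
noncomputable def affinePerm (g : G) (t : M) : Equiv.Perm M where
  toFun m := of ℤ G g • m + t
  invFun m := of ℤ G g⁻¹ • (m - t)
  left_inv m := by
    dsimp only
    rw [add_sub_cancel_right, smul_smul, ← map_mul, inv_mul_cancel, map_one, one_smul]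
  right_inv m := by
    dsimp only
    rw [smul_smul, ← map_mul, mul_inv_cancel, map_one, one_smul, sub_add_cancel]

theorem affinePerm_apply (g : G) (t m : M) : affinePerm g t m = of ℤ G g • m + t := rfl

theorem affinePerm_one : affinePerm (1 : G) (0 : M) = 1 := by
  ext m; rw [affinePerm_apply, map_one, one_smul, add_zero]; rfl

theorem affinePerm_mul (g h : G) (t s : M) :
    affinePerm g t * affinePerm h s = affinePerm (g * h) (of ℤ G g • s + t) := by
  ext m
  rw [Equiv.Perm.mul_apply, affinePerm_apply, affinePerm_apply, affinePerm_apply, map_mul,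
    smul_add, smul_smul, add_assoc]

/-- The coefficient `powerSum g k` is the Fox derivative of the `k`-th power. -/
theorem affinePerm_pow (g : G) (t : M) (k : ℕ) :
    affinePerm g t ^ k = affinePerm (g ^ k) (powerSum g k • t) := by
  induction k with
  | zero => rw [pow_zero, pow_zero, powerSum, Finset.sum_range_zero, zero_smul, affinePerm_one]
  | succ k ih =>
    rw [pow_succ, ih, affinePerm_mul, pow_succ, powerSum, powerSum, Finset.sum_range_succ,
      add_smul, map_pow, add_comm]

/-- For `k = n` the coefficients of the `t i` are the Fox derivatives of the relator `γ₁ ⋯ γₙ`. -/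
theorem prefixProd_affinePerm {n : ℕ} (γ : Fin n → G) (t : Fin n → M) (k : ℕ) (hk : k ≤ n) :
    prefixProd (fun i => affinePerm (γ i) (t i)) k = affinePerm (prefixProd γ k)
      (∑ i : Fin n, if (i : ℕ) < k then of ℤ G (prefixProd γ i) • t i else 0) := by
  induction k with
  | zero => simp [prefixProd_zero, affinePerm_one]
  | succ k ih =>
    have h1 := prefixProd_succ (fun i => affinePerm (γ i) (t i)) ⟨k, hk⟩
    have h2 := prefixProd_succ γ ⟨k, hk⟩
    simp only at h1 h2
    rw [h1, h2, ih (Nat.le_of_succ_le hk), affinePerm_mul]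
    congr 1
    have h3 : of ℤ G (prefixProd γ k) • t ⟨k, hk⟩ =
        ∑ i : Fin n, if i = ⟨k, hk⟩ then of ℤ G (prefixProd γ i) • t i else 0 := by
      rw [Finset.sum_ite_eq' Finset.univ (⟨k, hk⟩ : Fin n)]
      simp
    rw [h3, ← Finset.sum_add_distrib]
    refine Finset.sum_congr rfl fun i _ => ?_
    rcases lt_trichotomy (i : ℕ) k with h | h | h
    · rw [if_neg (by rintro rfl; simp at h), if_pos h, if_pos (by omega), zero_add]
    · rw [if_pos (Fin.ext h), if_neg (by omega), if_pos (by omega), add_zero]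
    · rw [if_neg (by rintro rfl; simp at h), if_neg (by omega), if_neg (by omega), zero_add]

end Affine

/-! ### Exactness of the polygonal chain complex -/

namespace IsPolygonPresentation

open MonoidAlgebra

variable {G : Type} [Group G] {n : ℕ} {e : Fin n → ℕ} {γ : Fin n → G}
  (h : IsPolygonPresentation e γ)

include h

theorem pow_eq_one (i : Fin n) : γ i ^ e i = 1 := by
  rw [← h.orderOf_eq, pow_orderOf_eq_one]

/-- Derivations are determined by the generators, subject only to the Fox derivatives of the
relators. -/
theorem exists_derivation {M : Type} [AddCommGroup M] [Module (MonoidAlgebra ℤ G) M]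
    (t : Fin n → M) (hpow : ∀ i, powerSum (γ i) (e i) • t i = 0)
    (hprod : ∑ i : Fin n, of ℤ G (prefixProd γ i) • t i = 0) :
    ∃ D : G → M, ∀ i x, D (x * γ i) = of ℤ G x • t i + D x := by
  -- The hypotheses on `t` say that the affine maps `m ↦ γᵢ m + tᵢ` satisfy the relators. The
  -- derivation is the translation part of the resulting action, the image of `0`.
  obtain ⟨φ, hφ⟩ := h.exists_hom (Equiv.Perm M) (fun i => affinePerm (γ i) (t i))
    (fun i => by rw [affinePerm_pow, h.pow_eq_one, hpow, affinePerm_one])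
    (by
      rw [← prefixProd_self, prefixProd_affinePerm γ t n le_rfl]
      simp only [Fin.is_lt, if_true]
      rw [hprod, prefixProd_self, h.prod_eq, affinePerm_one])
  have haff : ∀ g : G, φ g = affinePerm g (φ g 0) := fun g => by
    have hg : g ∈ Subgroup.closure (Set.range γ) := h.closure_eq_top ▸ Subgroup.mem_top g
    induction hg using Subgroup.closure_induction with
    | mem x hx =>
      obtain ⟨i, rfl⟩ := hx
      rw [hφ, affinePerm_apply, smul_zero, zero_add]
    | one => rw [map_one, Equiv.Perm.one_apply, affinePerm_one]
    | mul x y _ _ hx hy =>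
      rw [map_mul, Equiv.Perm.mul_apply]
      conv_lhs => rw [hx, hy, affinePerm_mul]
      conv_rhs => rw [hx, affinePerm_apply]
    | inv x _ hx =>
      have h1 : affinePerm x⁻¹ (-(of ℤ G x⁻¹ • φ x 0)) * φ x = 1 := by
        conv_lhs => rw [hx, affinePerm_mul]
        rw [inv_mul_cancel, ← affinePerm_one (G := G) (M := M)]
        congr 1
        rw [← hx]
        abel
      have h2 : φ x⁻¹ = affinePerm x⁻¹ (-(of ℤ G x⁻¹ • φ x 0)) := by
        rw [map_inv, eq_inv_of_mul_eq_one_left h1]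
      rw [h2, affinePerm_apply, smul_zero, zero_add]
  refine ⟨fun g => φ g 0, fun i x => ?_⟩
  simp only [map_mul, Equiv.Perm.mul_apply, hφ]
  rw [affinePerm_apply, smul_zero, zero_add, haff x, affinePerm_apply, affinePerm_apply,
    smul_zero, zero_add]

/-- The relations between the elements `γ i - 1` of the group ring come from the relators. -/
theorem exists_of_sum_mul_sub_eq_zero {y : Fin n → MonoidAlgebra ℤ G}
    (hy : ∑ i, y i * (of ℤ G (γ i) - 1) = 0) :
    ∃ (a : MonoidAlgebra ℤ G) (z : Fin n → MonoidAlgebra ℤ G),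
      ∀ i, y i = a * of ℤ G (prefixProd γ i) + z i * powerSum (γ i) (e i) := by
  classical
  -- `S` is spanned by the Fox derivatives of the relators, so the basis vectors modulo `S` are the
  -- values of a derivation. Its linear extension `L` sends `∑ y i * (γ i - 1)` to the class of `y`.
  let S : Submodule (MonoidAlgebra ℤ G) (Fin n → MonoidAlgebra ℤ G) :=
    Submodule.span _ {fun i : Fin n => of ℤ G (prefixProd γ i)} ⊔
      Submodule.span _ (Set.range fun i => Pi.single i (powerSum (γ i) (e i)))
  let t : Fin n → (Fin n → MonoidAlgebra ℤ G) ⧸ S := fun i => S.mkQ (Pi.single i 1)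
  have hsum : ∀ y : Fin n → MonoidAlgebra ℤ G, S.mkQ y = ∑ i, y i • t i := fun y => by
    simp only [t, ← map_smul, ← map_sum, ← Pi.single_smul, smul_eq_mul, mul_one,
      Finset.univ_sum_single]
  obtain ⟨D, hD⟩ := h.exists_derivation t
    (fun i => by
      rw [← map_smul, ← Pi.single_smul, smul_eq_mul, mul_one]
      exact (Submodule.Quotient.mk_eq_zero _).2
        (Submodule.mem_sup_right (Submodule.subset_span ⟨i, rfl⟩)))
    (by
      rw [← hsum fun i : Fin n => of ℤ G (prefixProd γ i)]
      exact (Submodule.Quotient.mk_eq_zero _).2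
        (Submodule.mem_sup_left (Submodule.subset_span rfl)))
  let L : MonoidAlgebra ℤ G →+ (Fin n → MonoidAlgebra ℤ G) ⧸ S :=
    (Finsupp.linearCombination ℤ D).toAddMonoidHom.comp
      (coeffAddEquiv (R := ℤ) (M := G)).toAddMonoidHom
  have hL : ∀ g r, L (single g r) = r • D g := fun g r => by simp [L]
  have hLy : ∀ (i : Fin n) (x : MonoidAlgebra ℤ G), L (x * (of ℤ G (γ i) - 1)) = x • t i := by
    intro i x
    induction x using MonoidAlgebra.induction_linear with
    | zero => simp
    | add x y hx hy => rw [add_mul, map_add, hx, hy, add_smul]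
    | single g r =>
      have hsr : single g r = r • of ℤ G g := by simp [of_apply]
      rw [mul_sub, mul_one, of_apply, single_mul_single, mul_one, map_sub, hL, hL, hD, hsr,
        smul_add, add_sub_cancel_right, smul_assoc]
  have hyS : S.mkQ y = 0 := by
    rw [hsum, ← map_zero L, ← hy, map_sum]
    exact Finset.sum_congr rfl fun i _ => (hLy i _).symm
  obtain ⟨u, hu, v, hv, huv⟩ := Submodule.mem_sup.1 ((Submodule.Quotient.mk_eq_zero _).1 hyS)
  obtain ⟨a, rfl⟩ := Submodule.mem_span_singleton.1 hu
  obtain ⟨z, rfl⟩ := (Submodule.mem_span_range_iff_exists_fun _).1 hv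
  refine ⟨a, z, fun i => ?_⟩
  rw [← huv]
  simp [Finset.sum_apply, Pi.single_apply]

/-- Exactness of the polygonal chain complex in degree one. -/
theorem exists_eq_boundary {x : Fin n → MonoidAlgebra ℤ G} (hsum : ∑ i, x i = 0)
    (hx : ∀ i, x i * powerSum (γ i) (e i) = 0) :
    ∃ a, ∀ i, x i = a * (of ℤ G (prefixProd γ i) * (of ℤ G (γ i) - 1)) := by
  -- The condition at the coset vertices puts `x i` in the left ideal of `γ i - 1`; the terms `z i *
  -- powerSum` found below are annihilated by `γ i - 1`.
  have hy : ∀ i, ∃ y, x i = y * (of ℤ G (γ i) - 1) := fun i =>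
    exists_eq_mul_sub (by rw [h.orderOf_eq]; exact h.pos i) (by rw [h.orderOf_eq, hx])
  choose y hy using hy
  obtain ⟨a, z, haz⟩ := h.exists_of_sum_mul_sub_eq_zero (y := y) (by simpa [hy] using hsum)
  refine ⟨a, fun i => ?_⟩
  rw [hy, haz, add_mul, mul_assoc (z i), powerSum_mul_sub (h.pow_eq_one i), mul_zero, add_zero,
    mul_assoc]

/-- Exactness of the polygonal chain complex in degree two. -/
theorem eq_zero_of_boundary_eq_zero [Infinite G] {a : MonoidAlgebra ℤ G}
    (ha : ∀ i : Fin n, a * (of ℤ G (prefixProd γ i) * (of ℤ G (γ i) - 1)) = 0) : a = 0 := by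
  -- The equations `a pᵢ γᵢ = a pᵢ` chain together from `p₀ = 1`, making `a` invariant under every
  -- generator.
  have hpre : ∀ k ≤ n, a * of ℤ G (prefixProd γ k) = a := fun k => by
    induction k with
    | zero => intro; rw [prefixProd_zero, map_one, mul_one]
    | succ k ih =>
      intro hk
      have h1 := ha ⟨k, hk⟩
      rw [mul_sub, mul_one, mul_sub, sub_eq_zero, ← map_mul] at h1
      rw [← prefixProd_succ γ ⟨k, hk⟩] at h1
      exact h1.trans (ih (Nat.le_of_succ_le hk))
  have hγ : ∀ i, a * of ℤ G (γ i) = a := fun i => by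
    have h1 := ha i
    rwa [← mul_assoc, hpre i i.2.le, mul_sub, mul_one, sub_eq_zero] at h1
  refine eq_zero_of_forall_mul_of_eq fun g => ?_
  have hg : g ∈ Subgroup.closure (Set.range γ) := h.closure_eq_top ▸ Subgroup.mem_top g
  induction hg using Subgroup.closure_induction with
  | mem x hx => obtain ⟨i, rfl⟩ := hx; exact hγ i
  | one => rw [map_one, mul_one]
  | mul x y _ _ hx hy => rw [map_mul, ← mul_assoc, hx, hy]
  | inv x _ hx =>
    conv_lhs => rw [← hx]
    rw [mul_assoc, ← map_mul, mul_inv_cancel, map_one, mul_one]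

/-- The terms telescope because `pᵢ γᵢ = pᵢ₊₁`: the boundary of a 2-cell closes up at the base
vertices. -/
theorem sum_boundary_eq_zero (a : MonoidAlgebra ℤ G) :
    ∑ i : Fin n, a * (of ℤ G (prefixProd γ i) * (of ℤ G (γ i) - 1)) = 0 := by
  have h1 : ∀ i : Fin n, of ℤ G (prefixProd γ i) * (of ℤ G (γ i) - 1) =
      of ℤ G (prefixProd γ (i + 1)) - of ℤ G (prefixProd γ i) := fun i => by
    rw [prefixProd_succ, map_mul, mul_sub, mul_one]
  rw [← Finset.mul_sum, Finset.sum_congr rfl fun i _ => h1 i,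
    Fin.sum_univ_eq_sum_range (fun i => of ℤ G (prefixProd γ (i + 1)) - of ℤ G (prefixProd γ i)) n,
    Finset.sum_range_sub fun i => of ℤ G (prefixProd γ i), prefixProd_self, h.prod_eq,
    prefixProd_zero, sub_self, mul_zero]

end IsPolygonPresentation

/-! ### Chains on the coset vertices -/

section CosetPush

open MonoidAlgebra

variable {G : Type*} [Group G]

/-- The push forward from the group ring to the finitely supported functions on the cosets. -/
noncomputable def cosetPush (H : Subgroup G) : MonoidAlgebra ℤ G →ₗ[ℤ] (G ⧸ H →₀ ℤ) :=
  Finsupp.lmapDomain ℤ ℤ (QuotientGroup.mk : G → G ⧸ H) ∘ₗ (coeffLinearEquiv ℤ).toLinearMap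

theorem cosetPush_apply (H : Subgroup G) (x : MonoidAlgebra ℤ G) :
    cosetPush H x = x.coeff.mapDomain (QuotientGroup.mk : G → G ⧸ H) := rfl

theorem cosetPush_of (H : Subgroup G) (g : G) :
    cosetPush H (of ℤ G g) = Finsupp.single (g : G ⧸ H) 1 := by
  rw [cosetPush_apply, of_apply, coeff_single, Finsupp.mapDomain_single]

theorem cosetPush_of_mul (H : Subgroup G) (g : G) (x : MonoidAlgebra ℤ G) :
    cosetPush H (of ℤ G g * x) =
      (cosetPush H x).mapDomain (MulAction.toPerm g : Equiv.Perm (G ⧸ H)) := by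
  rw [cosetPush_apply, cosetPush_apply, coeff_of_mul, ← Finsupp.mapDomain_comp,
    ← Finsupp.mapDomain_comp]
  rfl

theorem cosetPush_mul_of_sub_one {H : Subgroup G} {g : G} (hg : g ∈ H) (x : MonoidAlgebra ℤ G) :
    cosetPush H (x * (of ℤ G g - 1)) = 0 := by
  rw [mul_sub, mul_one, map_sub, sub_eq_zero, cosetPush_apply, cosetPush_apply, coeff_mul_of,
    ← Finsupp.mapDomain_comp]
  congr 1
  funext a
  exact QuotientGroup.eq.2 (by simpa using hg)

/-- At a fixed coset every translate by a power of `h` has the same coefficient. -/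
theorem cosetPush_powerSum_mul_apply {H : Subgroup G} {h : G} {c : G ⧸ H} (hc : h • c = c) (m : ℕ)
    (x : MonoidAlgebra ℤ G) : cosetPush H (powerSum h m * x) c = m * cosetPush H x c := by
  have hc' : ∀ j : ℕ, (h ^ j)⁻¹ • c = c := fun j => by
    have h1 : h ∈ MulAction.stabilizer G c := hc
    exact inv_mem (pow_mem h1 j)
  have hj : ∀ j : ℕ, cosetPush H (of ℤ G h ^ j * x) c = cosetPush H x c := fun j => by
    rw [← map_pow, cosetPush_of_mul, Finsupp.mapDomain_equiv_apply, MulAction.toPerm_symm_apply,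
      hc']
  rw [powerSum, Finset.sum_mul, map_sum, Finsupp.finsetSum_apply,
    Finset.sum_congr rfl fun j _ => hj j]
  simp

theorem of_mul_powerSum {g c : G} {m : ℕ} (hm0 : 0 < m) (hm : g ^ m = 1)
    (hc : c ∈ Subgroup.zpowers g) : of ℤ G c * powerSum g m = powerSum g m := by
  have hfin : IsOfFinOrder g := isOfFinOrder_iff_pow_eq_one.2 ⟨m, hm0, hm⟩
  obtain ⟨k, rfl⟩ := (hfin.mem_powers_iff_mem_zpowers).2 hc
  have h1 : of ℤ G g * powerSum g m = powerSum g m := by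
    have := sub_mul_powerSum hm
    rwa [sub_mul, one_mul, sub_eq_zero] at this
  induction k with
  | zero => simp [← one_def]
  | succ k ih =>
    simp only at ih ⊢
    rw [pow_succ, map_mul, mul_assoc, h1]
    exact ih (Subgroup.npow_mem_zpowers g k)

end CosetPush

/-! ### Fixed vertices of elements of finite order -/

namespace IsPolygonPresentation

open MonoidAlgebra

variable {G : Type} [Group G] {n : ℕ} {e : Fin n → ℕ} {γ : Fin n → G}
  (h : IsPolygonPresentation e γ)

include h

/-- Suppose `g` fixes no coset vertex. The translates by powers of `g` of a path from `1` to `g`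
form a closed chain, which bounds some `a`; chasing this back through free modules shows that `1`
has augmentation divisible by `p`. -/
theorem exists_conj_mem_of_prime [Infinite G] {g : G} {p : ℕ} (hp : p.Prime)
    (hg : orderOf g = p) : ∃ i x, x⁻¹ * g * x ∈ Subgroup.zpowers (γ i) := by
  by_contra! hno
  have hg0 : 0 < orderOf g := hg ▸ hp.pos
  have hgp : g ^ p = 1 := hg ▸ pow_orderOf_eq_one g
  obtain ⟨y, hy⟩ := exists_of_sub_one_eq_sum h.closure_eq_top g
  obtain ⟨a, ha⟩ := h.exists_eq_boundary
    (x := fun i => powerSum g p * (y i * (of ℤ G (γ i) - 1)))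
    (by rw [← Finset.mul_sum, ← hy, powerSum_mul_sub hgp])
    (fun i => by rw [mul_assoc, mul_assoc, sub_mul_powerSum (h.pow_eq_one i), mul_zero, mul_zero])
  have ha0 : (of ℤ G g - 1) * a = 0 := h.eq_zero_of_boundary_eq_zero fun i => by
    rw [mul_assoc, ← ha, ← mul_assoc, sub_mul_powerSum hgp, zero_mul]
  obtain ⟨a', rfl⟩ := exists_eq_powerSum_mul hg0 ha0
  rw [hg] at ha
  -- Correcting the path by the boundary of `a'` makes its norm vanish, so it is a `(g -
  -- 1)`-multiple.
  have hx' : ∀ i, ∃ x', y i * (of ℤ G (γ i) - 1) -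
      a' * (of ℤ G (prefixProd γ i) * (of ℤ G (γ i) - 1)) = (of ℤ G g - 1) * x' := fun i =>
    exists_eq_sub_mul hg0 (by rw [hg, mul_sub, ha, mul_assoc, sub_self])
  choose x' hx' using hx'
  have hinv : (of ℤ G g - 1) * (1 - ∑ i, x' i) = 0 := by
    rw [mul_sub, mul_one, Finset.mul_sum, ← Finset.sum_congr rfl fun i _ => hx' i,
      Finset.sum_sub_distrib, ← hy, h.sum_boundary_eq_zero, sub_zero, sub_self]
  let aug : MonoidAlgebra ℤ G →ₗ[ℤ] ℤ :=
    Finsupp.linearCombination ℤ (fun _ => (1 : ℤ)) ∘ₗ (coeffLinearEquiv ℤ).toLinearMap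
  have haug : ∀ x, aug x = Finsupp.linearCombination ℤ (fun _ => (1 : ℤ)) x.coeff := fun _ => rfl
  -- This element is `g`-invariant, and `g` acts on `G` without fixed points.
  have h1 : (p : ℤ) ∣ aug (1 - ∑ i, x' i) := by
    rw [haug]
    refine dvd_sum_of_mapDomain_eq hp (σ := Equiv.mulLeft g) (hg ▸ mulLeft_pow_orderOf g)
      (fun x => ?_) ?_
    · rw [Equiv.coe_mulLeft, Ne, mul_eq_right]
      rintro rfl
      rw [orderOf_one] at hg
      exact hp.one_lt.ne hg
    · rw [← coeff_of_mul]
      rw [sub_mul, one_mul, sub_eq_zero] at hinv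
      rw [hinv]
  -- On the cosets of `⟨γ i⟩` the left side of `hx'` dies, so the image of `x' i` is `g`-invariant;
  -- by assumption `g` fixes no coset.
  have h2 : ∀ i, (p : ℤ) ∣ aug (x' i) := fun i => by
    have hpush : aug (x' i) = Finsupp.linearCombination ℤ (fun _ => (1 : ℤ))
        (cosetPush (Subgroup.zpowers (γ i)) (x' i)) := by
      rw [cosetPush_apply, Finsupp.linearCombination_mapDomain, haug]
      rfl
    rw [hpush]
    refine dvd_sum_of_mapDomain_eq hp (σ := MulAction.toPerm g) ?_ (fun c => ?_) ?_
    · ext c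
      rw [← MulAction.toPermHom_apply, ← map_pow, hgp, map_one]
    · induction c using QuotientGroup.induction_on with
      | H x =>
        intro hc
        refine hno i x ?_
        have := QuotientGroup.eq.1 (show ((g * x : G) : G ⧸ Subgroup.zpowers (γ i)) = x from hc)
        have := inv_mem this
        rwa [mul_inv_rev, inv_inv, ← mul_assoc] at this
    · rw [← cosetPush_of_mul]
      have := congrArg (cosetPush (Subgroup.zpowers (γ i))) (hx' i)
      rw [map_sub, cosetPush_mul_of_sub_one (Subgroup.mem_zpowers _), ← mul_assoc,
        cosetPush_mul_of_sub_one (Subgroup.mem_zpowers _), sub_zero, sub_mul, one_mul,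
        map_sub] at this
      exact sub_eq_zero.1 this.symm
  rw [map_sub, map_sum] at h1
  have h4 := dvd_add h1 (Finset.dvd_sum fun i (_ : i ∈ Finset.univ) => h2 i)
  rw [sub_add_cancel] at h4
  have h5 : aug 1 = 1 := by
    rw [haug, one_def, coeff_single, Finsupp.linearCombination_single, smul_eq_mul, mul_one]
  rw [h5] at h4
  have := Int.le_of_dvd one_pos h4
  have := hp.two_le
  omega

/-- A path between two distinct fixed vertices could be corrected by a boundary to a `g`-norm. Its
coefficient at a fixed end vertex would then be divisible by `p`, yet it is `1`. -/
theorem eq_of_conj_mem_of_prime [Infinite G] {g : G} {p : ℕ} (hp : p.Prime)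
    (hg : orderOf g = p) {i j : Fin n} {x y : G} (hx : x⁻¹ * g * x ∈ Subgroup.zpowers (γ i))
    (hy : y⁻¹ * g * y ∈ Subgroup.zpowers (γ j)) :
    i = j ∧ x⁻¹ * y ∈ Subgroup.zpowers (γ i) := by
  by_contra hne
  have hg0 : 0 < orderOf g := hg ▸ hp.pos
  have hgp : g ^ p = 1 := hg ▸ pow_orderOf_eq_one g
  obtain ⟨w, hw⟩ := exists_of_sub_one_eq_sum h.closure_eq_top (x⁻¹ * y)
  -- The chain joining `x⟨γ i⟩` and `y⟨γ j⟩`: one edge at each end, and the path from `x` to `y`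
  -- between base vertices.
  let u : Fin n → MonoidAlgebra ℤ G := fun k =>
    Pi.single (M := fun _ => MonoidAlgebra ℤ G) i (of ℤ G x) k -
      Pi.single (M := fun _ => MonoidAlgebra ℤ G) j (of ℤ G y) k +
      of ℤ G x * w k * (of ℤ G (γ k) - 1)
  have hu : ∑ k, u k = 0 := by
    simp only [u, Finset.sum_add_distrib, Finset.sum_sub_distrib, mul_assoc, ← Finset.mul_sum]
    rw [← hw, mul_sub, ← map_mul, mul_inv_cancel_left, mul_one, Finset.sum_pi_single' ]
    simp
  have hfix : ∀ (k : Fin n) (x : G), x⁻¹ * g * x ∈ Subgroup.zpowers (γ k) →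
      (of ℤ G g - 1) * of ℤ G x * powerSum (γ k) (e k) = 0 := fun k x hx => by
    have h1 : g * x = x * (x⁻¹ * g * x) := by group
    rw [sub_mul, one_mul, ← map_mul, h1, map_mul, sub_mul, mul_assoc,
      of_mul_powerSum (h.pos k) (h.pow_eq_one k) hx, sub_self]
  -- As `g` fixes both ends, `(g - 1) u` is closed.
  obtain ⟨a, ha⟩ := h.exists_eq_boundary (x := fun k => (of ℤ G g - 1) * u k)
    (by rw [← Finset.mul_sum, hu, mul_zero])
    (fun k => by
      have h1 : (of ℤ G g - 1) * Pi.single (M := fun _ => MonoidAlgebra ℤ G) i (of ℤ G x) k *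
          powerSum (γ k) (e k) = 0 := by
        rcases eq_or_ne k i with rfl | hk
        · rw [Pi.single_eq_same, hfix _ _ hx]
        · rw [Pi.single_eq_of_ne hk, mul_zero, zero_mul]
      have h2 : (of ℤ G g - 1) * Pi.single (M := fun _ => MonoidAlgebra ℤ G) j (of ℤ G y) k *
          powerSum (γ k) (e k) = 0 := by
        rcases eq_or_ne k j with rfl | hk
        · rw [Pi.single_eq_same, hfix _ _ hy]
        · rw [Pi.single_eq_of_ne hk, mul_zero, zero_mul]
      simp only [u]
      rw [mul_add, mul_sub, add_mul, sub_mul, h1, h2, ← mul_assoc, mul_assoc _ _ (powerSum _ _),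
        sub_mul_powerSum (h.pow_eq_one k), mul_zero, sub_self, add_zero])
  have ha0 : powerSum g p * a = 0 := h.eq_zero_of_boundary_eq_zero fun k => by
    rw [mul_assoc, ← ha, ← mul_assoc, powerSum_mul_sub hgp, zero_mul]
  obtain ⟨a', rfl⟩ := exists_eq_sub_mul hg0 (hg.symm ▸ ha0)
  obtain ⟨v, hv⟩ := exists_eq_powerSum_mul hg0
    (x := u i - a' * (of ℤ G (prefixProd γ i) * (of ℤ G (γ i) - 1)))
    (by rw [mul_sub, ha, mul_assoc, sub_self])
  rw [hg] at hv
  have hc : g • (x : G ⧸ Subgroup.zpowers (γ i)) = x := by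
    refine QuotientGroup.eq.2 ?_
    have := inv_mem hx
    rwa [mul_inv_rev, mul_inv_rev, inv_inv, ← mul_assoc, ← mul_inv_rev] at this
  have hval := congrArg (fun f => cosetPush (Subgroup.zpowers (γ i)) f x) hv
  simp only [u] at hval
  rw [cosetPush_powerSum_mul_apply hc, map_sub, map_add,
    cosetPush_mul_of_sub_one (Subgroup.mem_zpowers _), ← mul_assoc,
    cosetPush_mul_of_sub_one (Subgroup.mem_zpowers _), sub_zero, add_zero, Pi.single_eq_same,
    map_sub, cosetPush_of, Finsupp.sub_apply, Finsupp.single_eq_same] at hval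
  have hj : cosetPush (Subgroup.zpowers (γ i))
      (Pi.single (M := fun _ => MonoidAlgebra ℤ G) j (of ℤ G y) i) x = 0 := by
    rcases eq_or_ne i j with rfl | hij
    · rw [Pi.single_eq_same, cosetPush_of, Finsupp.single_apply, if_neg]
      intro hyx
      exact hne ⟨rfl, QuotientGroup.eq.1 hyx.symm⟩
    · rw [Pi.single_eq_of_ne hij, map_zero]; rfl
  rw [hj, sub_zero] at hval
  have := Int.le_of_dvd one_pos (Dvd.intro _ hval.symm)
  have := hp.two_le
  omega

/-- A nontrivial element of finite order fixes a coset of a subgroup generated by some `γ i`. -/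
theorem exists_conj_mem [Infinite G] {g : G} (hfin : IsOfFinOrder g) (hg : g ≠ 1) :
    ∃ i x, x⁻¹ * g * x ∈ Subgroup.zpowers (γ i) := by
  obtain ⟨p, hp, hpg⟩ := Nat.exists_prime_and_dvd (n := orderOf g) (by rwa [Ne, orderOf_eq_one_iff])
  have hord : orderOf (g ^ (orderOf g / p)) = p :=
    orderOf_pow_orderOf_div hfin.orderOf_pos.ne' hpg
  obtain ⟨i, x, hx⟩ := h.exists_conj_mem_of_prime hp hord
  refine ⟨i, x, ?_⟩
  -- Since `g` commutes with its power of order `p`, it permutes the fixed cosets of that power;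
  -- there is only one.
  have hgx : (g * x)⁻¹ * g ^ (orderOf g / p) * (g * x) = x⁻¹ * g ^ (orderOf g / p) * x := by
    rw [mul_inv_rev, mul_assoc x⁻¹, ((Commute.refl g).pow_right _).inv_left.eq]
    group
  have := (h.eq_of_conj_mem_of_prime hp hord hx (by rw [hgx]; exact hx)).2
  rwa [← mul_assoc] at this

/-- A nontrivial element of finite order fixes at most one coset of the subgroups generated by the
`γ i`. -/
theorem eq_of_conj_mem [Infinite G] {g : G} (hfin : IsOfFinOrder g) (hg : g ≠ 1) {i j : Fin n}
    {x y : G} (hx : x⁻¹ * g * x ∈ Subgroup.zpowers (γ i))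
    (hy : y⁻¹ * g * y ∈ Subgroup.zpowers (γ j)) :
    i = j ∧ x⁻¹ * y ∈ Subgroup.zpowers (γ i) := by
  obtain ⟨p, hp, hpg⟩ := Nat.exists_prime_and_dvd (n := orderOf g) (by rwa [Ne, orderOf_eq_one_iff])
  have hord : orderOf (g ^ (orderOf g / p)) = p :=
    orderOf_pow_orderOf_div hfin.orderOf_pos.ne' hpg
  have hpow : ∀ (z : G) (k : ℕ), z⁻¹ * g ^ k * z = (z⁻¹ * g * z) ^ k := fun z k => by
    simpa using (conj_pow (i := k) (a := z⁻¹) (b := g)).symm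
  exact h.eq_of_conj_mem_of_prime hp hord (by rw [hpow]; exact pow_mem hx _)
    (by rw [hpow]; exact pow_mem hy _)

/-- The group of a polygon with at least two vertices of nontrivial order has trivial centre. -/
theorem eq_one_of_forall_commute [Infinite G] {i j : Fin n} (hij : i ≠ j) (hi : 2 ≤ e i)
    (hj : 2 ≤ e j) {z : G} (hz : ∀ x, z * x = x * z) : z = 1 := by
  have hmem : ∀ k, 2 ≤ e k → z ∈ Subgroup.zpowers (γ k) := fun k hk => by
    -- As `z` commutes with `γ k`, the cosets of `1` and of `z` are both fixed by `γ k`, hence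
    -- equal.
    have hord : 2 ≤ orderOf (γ k) := (h.orderOf_eq k).symm ▸ hk
    have h1 : (1 : G)⁻¹ * γ k * 1 ∈ Subgroup.zpowers (γ k) := by simp
    have h2 : z⁻¹ * γ k * z ∈ Subgroup.zpowers (γ k) := by
      rw [mul_assoc, ← hz, inv_mul_cancel_left]
      exact Subgroup.mem_zpowers _
    have := (h.eq_of_conj_mem (orderOf_pos_iff.1 (by omega))
      (by rw [Ne, ← orderOf_eq_one_iff]; omega) h1 h2).2
    simpa using this
  by_contra hz1
  have hfin : IsOfFinOrder z := by
    have h1 : IsOfFinOrder (γ i) := orderOf_pos_iff.1 ((h.orderOf_eq i).symm ▸ h.pos i)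
    obtain ⟨k, hk⟩ := hmem i hi
    rw [← hk]
    exact h1.zpow
  exact hij (h.eq_of_conj_mem (x := 1) (y := 1) hfin hz1 (by simpa using hmem i hi)
    (by simpa using hmem j hj)).1

end IsPolygonPresentation

/-! ### Torsion free groups with centre of finite index -/

/-- A torsion free group with centre of finite index is abelian, by the transfer to the centre. -/
theorem mul_comm_of_finiteIndex_center {G : Type*} [Group G]
    (htf : ∀ (a : G) (m : ℕ), m ≠ 0 → a ^ m = 1 → a = 1) [(Subgroup.center G).FiniteIndex]
    (a b : G) : a * b = b * a := by
  -- The transfer to the centre is `x ↦ x ^ [G : Z(G)]`, injective in the absence of torsion, and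
  -- its target is abelian.
  have hinj : Function.Injective (MonoidHom.transferCenterPow G) := by
    refine (injective_iff_map_eq_one _).2 fun x hx => ?_
    refine htf x _ (Subgroup.FiniteIndex.index_ne_zero (H := Subgroup.center G)) ?_
    rw [← MonoidHom.transferCenterPow_apply, hx]
    rfl
  apply hinj
  rw [map_mul, map_mul]
  exact Subtype.ext (Subgroup.mem_center_iff.1 (MonoidHom.transferCenterPow G b).2 _)

/-! ### Passage between `P` and its quotient by `⟨c⟩` -/

namespace IsStandardGenerators

variable {P : Type} [Group P] {n : ℕ} {e : Fin n → ℕ} {γ : Fin n → P} {c : P}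
  (hP : IsStandardGenerators e γ c)

include hP

theorem lift_eq_one {r : FreeGroup (Option (Fin n))} (hr : r ∈ fuchsianRelators e) :
    FreeGroup.lift (fun x : Option (Fin n) => x.elim c γ) r = 1 := by
  rw [← MonoidHom.mem_ker, hP.ker_eq]
  exact Subgroup.subset_normalClosure hr

theorem gen_mul_comm (i : Fin n) : γ i * c = c * γ i := by
  have := hP.lift_eq_one (Or.inl (Or.inl ⟨i, rfl⟩))
  simp only [map_mul, map_inv, FreeGroup.lift_apply_of, Option.elim] at this
  rwa [mul_inv_eq_one, mul_inv_eq_iff_eq_mul] at this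

theorem gen_pow (i : Fin n) : γ i ^ e i = c := by
  have := hP.lift_eq_one (Or.inl (Or.inr ⟨i, rfl⟩))
  simp only [map_mul, map_inv, map_pow, FreeGroup.lift_apply_of, Option.elim] at this
  rwa [mul_inv_eq_one] at this

theorem gen_prod : (List.ofFn γ).prod = c ^ ((n : ℤ) - 2) := by
  have := hP.lift_eq_one (Or.inr rfl)
  simp only [map_mul, map_inv, map_zpow, map_list_prod, List.map_ofFn, FreeGroup.lift_apply_of,
    Option.elim, Function.comp_def] at this
  rwa [mul_inv_eq_one] at this

theorem mul_comm_gen (x : P) : x * c = c * x := by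
  have hx : x ∈ Subgroup.closure (insert c (Set.range γ)) := hP.closure_eq_top ▸ Subgroup.mem_top x
  have hle : Subgroup.closure (insert c (Set.range γ)) ≤ Subgroup.centralizer {c} := by
    rw [Subgroup.closure_le]
    rintro y (rfl | ⟨i, rfl⟩)
    · exact Subgroup.mem_centralizer_singleton_iff.2 rfl
    · exact Subgroup.mem_centralizer_singleton_iff.2 (hP.gen_mul_comm i)
  exact Subgroup.mem_centralizer_singleton_iff.1 (hle hx)

theorem zpowers_le_center : Subgroup.zpowers c ≤ Subgroup.center P := by
  rw [Subgroup.zpowers_le, Subgroup.mem_center_iff]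
  exact fun x => hP.mul_comm_gen x

theorem normal_zpowers : (Subgroup.zpowers c).Normal :=
  ⟨fun a ha x => by
    rw [Subgroup.mem_center_iff.1 (hP.zpowers_le_center ha) x, mul_inv_cancel_right]
    exact ha⟩

theorem exists_lift {H : Type*} [Group H] (f : Fin n → H) (hpow : ∀ i, f i ^ e i = 1)
    (hprod : (List.ofFn f).prod = 1) : ∃ φ : P →* H, φ c = 1 ∧ ∀ i, φ (γ i) = f i := by
  let L := FreeGroup.lift fun x : Option (Fin n) => x.elim c γ
  let F := FreeGroup.lift fun x : Option (Fin n) => x.elim 1 f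
  have hsurj : Function.Surjective L := by
    rw [← MonoidHom.range_eq_top, eq_top_iff, ← hP.closure_eq_top, Subgroup.closure_le]
    rintro y (rfl | ⟨i, rfl⟩)
    · exact ⟨FreeGroup.of none, FreeGroup.lift_apply_of⟩
    · exact ⟨FreeGroup.of (some i), FreeGroup.lift_apply_of⟩
  have hker : L.ker ≤ F.ker := by
    rw [hP.ker_eq]
    refine Subgroup.normalClosure_le_normal ?_
    rintro r ((⟨i, rfl⟩ | ⟨i, rfl⟩) | rfl)
    · simp [F, MonoidHom.mem_ker]
    · simp [F, MonoidHom.mem_ker, hpow]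
    · simp [F, MonoidHom.mem_ker, map_list_prod, List.map_ofFn, Function.comp_def, hprod]
  let φ := L.liftOfSurjective hsurj ⟨F, hker⟩
  have hφ : ∀ x, φ (L x) = F x := fun x =>
    MonoidHom.liftOfRightInverse_comp_apply L _ (Function.rightInverse_surjInv hsurj) ⟨F, hker⟩ x
  refine ⟨φ, ?_, fun i => ?_⟩
  · simpa [L, F] using hφ (FreeGroup.of none)
  · simpa [L, F] using hφ (FreeGroup.of (some i))

/-- If `c = 1`, every `γ i` is torsion, hence trivial, and so is `P`. -/
theorem gen_ne_one (htf : ∀ (a : P) (m : ℕ), m ≠ 0 → a ^ m = 1 → a = 1) (he : ∀ i, 0 < e i)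
    {x : P} (hx : x ≠ 1) : c ≠ 1 := by
  rintro rfl
  have hγ : ∀ i, γ i = 1 := fun i => htf _ _ (he i).ne' (hP.gen_pow i)
  have hle : Subgroup.closure (insert 1 (Set.range γ)) ≤ ⊥ := by
    rw [Subgroup.closure_le]
    rintro y (rfl | ⟨i, rfl⟩)
    · exact Subgroup.mem_bot.2 rfl
    · exact Subgroup.mem_bot.2 (hγ i)
  rw [hP.closure_eq_top] at hle
  exact hx (Subgroup.mem_bot.1 (hle (Subgroup.mem_top x)))

theorem zpow_injective (htf : ∀ (a : P) (m : ℕ), m ≠ 0 → a ^ m = 1 → a = 1) (he : ∀ i, 0 < e i)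
    {x : P} (hx : x ≠ 1) : Function.Injective fun k : ℤ => c ^ k := by
  refine injective_zpow_iff_not_isOfFinOrder.2 fun hc => ?_
  obtain ⟨m, hm, hcm⟩ := isOfFinOrder_iff_pow_eq_one.1 hc
  exact hP.gen_ne_one htf he hx (htf c m hm.ne' hcm)

theorem isPolygonPresentation [(Subgroup.zpowers c).Normal]
    (htf : ∀ (a : P) (m : ℕ), m ≠ 0 → a ^ m = 1 → a = 1) (he : ∀ i, 0 < e i)
    {x : P} (hx : x ≠ 1) :
    IsPolygonPresentation e fun i => (γ i : P ⧸ Subgroup.zpowers c) where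
  closure_eq_top := by
    have h := congrArg (Subgroup.map (QuotientGroup.mk' (Subgroup.zpowers c))) hP.closure_eq_top
    rw [MonoidHom.map_closure, Subgroup.map_top_of_surjective _ (QuotientGroup.mk'_surjective _),
      Set.image_insert_eq, ← Set.range_comp] at h
    rw [eq_top_iff, ← h, Subgroup.closure_le]
    rintro y (rfl | ⟨i, rfl⟩)
    · have : QuotientGroup.mk' (Subgroup.zpowers c) c = 1 :=
        (QuotientGroup.eq_one_iff c).2 (Subgroup.mem_zpowers c)
      rw [this]
      exact one_mem _
    · exact Subgroup.subset_closure ⟨i, rfl⟩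
  pos := he
  orderOf_eq i := by
    refine (orderOf_eq_iff (he i)).2 ⟨?_, fun m hm hm0 h1 => ?_⟩
    · rw [← QuotientGroup.mk_pow, hP.gen_pow]
      exact (QuotientGroup.eq_one_iff c).2 (Subgroup.mem_zpowers c)
    · rw [← QuotientGroup.mk_pow, QuotientGroup.eq_one_iff] at h1
      obtain ⟨k, hk⟩ := h1
      -- Raise `γ i ^ m = c ^ k` to the power `e i`; infinite order of `c` then gives `e i ∣ m`.
      have h2 : c ^ (m : ℤ) = c ^ (k * (e i : ℤ)) := by
        rw [zpow_mul, zpow_natCast, zpow_natCast]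
        simp only at hk
        rw [hk, ← hP.gen_pow i, ← pow_mul, ← pow_mul, mul_comm]
      have h3 : (m : ℤ) = k * e i := hP.zpow_injective htf he hx h2
      have h4 : e i ∣ m := by exact_mod_cast Dvd.intro_left k h3.symm
      exact absurd (Nat.le_of_dvd hm0 h4) (by omega)
  prod_eq := by
    have h1 : (List.ofFn fun i => (γ i : P ⧸ Subgroup.zpowers c)).prod =
        QuotientGroup.mk' (Subgroup.zpowers c) (List.ofFn γ).prod := by
      rw [map_list_prod, List.map_ofFn]
      rfl
    rw [h1, hP.gen_prod]
    exact (QuotientGroup.eq_one_iff _).2 ⟨_, rfl⟩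
  exists_hom H _ f hpow hprod := by
    obtain ⟨φ, hc, hφ⟩ := hP.exists_lift f hpow hprod
    exact ⟨QuotientGroup.lift _ φ ((Subgroup.zpowers_le).2 hc), fun i => hφ i⟩

/-- A finite quotient would give `P` a centre of finite index, and so make it abelian. -/
theorem infinite_quotient [(Subgroup.zpowers c).Normal]
    (htf : ∀ (a : P) (m : ℕ), m ≠ 0 → a ^ m = 1 → a = 1) {x : P} (hx : x ∉ Subgroup.center P) :
    Infinite (P ⧸ Subgroup.zpowers c) := by
  by_contra hfin
  rw [not_infinite_iff_finite] at hfin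
  have h1 : (Subgroup.zpowers c).FiniteIndex := Subgroup.finiteIndex_of_finite_quotient
  have h2 : (Subgroup.center P).FiniteIndex := Subgroup.finiteIndex_of_le hP.zpowers_le_center
  exact hx (Subgroup.mem_center_iff.2 fun y => mul_comm_of_finiteIndex_center htf y x)

theorem center_eq_zpowers (htf : ∀ (a : P) (m : ℕ), m ≠ 0 → a ^ m = 1 → a = 1)
    (he : ∀ i, 2 ≤ e i) (hn : 2 ≤ n) {x : P} (hx : x ∉ Subgroup.center P) :
    Subgroup.center P = Subgroup.zpowers c := by
  have hnormal := hP.normal_zpowers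
  have hinf := hP.infinite_quotient htf hx
  have he0 : ∀ i, 0 < e i := fun i => by have := he i; omega
  have hx1 : x ≠ 1 := by rintro rfl; exact hx (one_mem _)
  refine le_antisymm (fun z hz => ?_) hP.zpowers_le_center
  rw [← QuotientGroup.eq_one_iff]
  refine (hP.isPolygonPresentation htf he0 hx1).eq_one_of_forall_commute
    (i := ⟨0, by omega⟩) (j := ⟨1, by omega⟩) (by simp) (he _) (he _) fun y => ?_
  induction y using QuotientGroup.induction_on with
  | H y => rw [← QuotientGroup.mk_mul, ← QuotientGroup.mk_mul, Subgroup.mem_center_iff.1 hz y]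

/-- The classification of the elements that are torsion modulo the centre. -/
theorem existsUnique_isConj (htf : ∀ (a : P) (m : ℕ), m ≠ 0 → a ^ m = 1 → a = 1)
    (he : ∀ i, 2 ≤ e i) (hn : 2 ≤ n) (g : P) (hg : g ∉ Subgroup.center P) {m : ℕ} (hm : 0 < m)
    (hgm : g ^ m ∈ Subgroup.center P) :
    ∃! t : Fin n × ℕ × ℤ,
      0 < t.2.1 ∧ t.2.1 < e t.1 ∧ IsConj g (γ t.1 ^ t.2.1 * c ^ t.2.2) := by
  have hnormal := hP.normal_zpowers
  have hinf := hP.infinite_quotient htf hg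
  have he0 : ∀ i, 0 < e i := fun i => by have := he i; omega
  have hg1 : g ≠ 1 := by rintro rfl; exact hg (one_mem _)
  have hQ := hP.isPolygonPresentation htf he0 hg1
  have hZ := hP.center_eq_zpowers htf he hn hg
  rw [hZ] at hg hgm
  have hq1 : (g : P ⧸ Subgroup.zpowers c) ≠ 1 := by rwa [Ne, QuotientGroup.eq_one_iff]
  have hqfin : IsOfFinOrder (g : P ⧸ Subgroup.zpowers c) :=
    isOfFinOrder_iff_pow_eq_one.2 ⟨m, hm, by rwa [← QuotientGroup.mk_pow, QuotientGroup.eq_one_iff]⟩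
  have hcentral : ∀ (k : ℤ) (x : P), x * c ^ k = c ^ k * x := fun k x =>
    Subgroup.mem_center_iff.1 (hP.zpowers_le_center ⟨k, rfl⟩) x
  have hcq : ∀ k : ℤ, ((c ^ k : P) : P ⧸ Subgroup.zpowers c) = 1 := fun k =>
    (QuotientGroup.eq_one_iff (c ^ k)).2 ⟨k, rfl⟩
  have hconj : ∀ {i : Fin n} {v : ℕ} {u : ℤ} {x : P}, x * g * x⁻¹ = γ i ^ v * c ^ u →
      ((x : P ⧸ Subgroup.zpowers c)⁻¹)⁻¹ * g * (x : P ⧸ Subgroup.zpowers c)⁻¹ = (γ i : _) ^ v := by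
    intro i v u x hx
    rw [inv_inv, ← QuotientGroup.mk_inv, ← QuotientGroup.mk_mul, ← QuotientGroup.mk_mul, hx,
      QuotientGroup.mk_mul, QuotientGroup.mk_pow, hcq u,
      mul_one]
  obtain ⟨i, x, hx⟩ := hQ.exists_conj_mem hqfin hq1
  induction x using QuotientGroup.induction_on with
  | H x =>
  obtain ⟨k, hk⟩ := hx
  simp only [← QuotientGroup.mk_inv, ← QuotientGroup.mk_mul, ← QuotientGroup.mk_zpow] at hk
  obtain ⟨l, hl⟩ := QuotientGroup.eq.1 hk
  simp only at hl
  have hgx : x⁻¹ * g * x = γ i ^ k * c ^ l := by rw [hl]; group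
  have he' : (e i : ℤ) ≠ 0 := by exact_mod_cast (he0 i).ne'
  obtain ⟨v, hv⟩ := Int.eq_ofNat_of_zero_le (Int.emod_nonneg k he')
  have hve : v < e i := by
    have := Int.emod_lt_of_pos k (by exact_mod_cast he0 i : (0 : ℤ) < e i)
    omega
  -- The exponent `k` is reduced modulo `e i`, the quotient passing into `c` by `γ i ^ e i = c`.
  have hgv : x⁻¹ * g * x = γ i ^ v * c ^ (k / e i + l) := by
    rw [hgx, ← zpow_natCast (γ i) v, ← hv]
    conv_lhs => rw [← Int.emod_add_mul_ediv k (e i), zpow_add, zpow_mul, zpow_natCast, hP.gen_pow]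
    rw [mul_assoc, ← zpow_add]
  refine ⟨⟨i, v, k / e i + l⟩, ⟨Nat.pos_of_ne_zero ?_, hve, ?_⟩, ?_⟩
  · rintro rfl
    refine hg ⟨k / e i + l, ?_⟩
    simp only
    have h1 : g = x * (x⁻¹ * g * x) * x⁻¹ := by group
    rw [h1, hgv, pow_zero, one_mul, hcentral, mul_inv_cancel_right]
  · exact isConj_iff.2 ⟨x⁻¹, by rw [inv_inv, hgv]⟩
  · rintro ⟨j, w, s⟩ ⟨-, hwe, hconjj⟩
    simp only at hwe hconjj
    obtain ⟨y, hy⟩ := isConj_iff.1 hconjj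
    have hxc := hconj (x := x⁻¹) (by rw [inv_inv, hgv])
    have hyc := hconj hy
    obtain ⟨rfl, hmem⟩ := hQ.eq_of_conj_mem hqfin hq1
      (by rw [hxc]; exact Subgroup.npow_mem_zpowers _ _)
      (by rw [hyc]; exact Subgroup.npow_mem_zpowers _ _)
    obtain ⟨a, ha⟩ := hmem
    simp only [← QuotientGroup.mk_inv, ← QuotientGroup.mk_mul, ← QuotientGroup.mk_zpow] at ha
    obtain ⟨b, hb⟩ := QuotientGroup.eq.1 ha
    simp only [inv_inv] at hb
    have hyx : x⁻¹ * y⁻¹ = γ i ^ a * c ^ b := by rw [hb]; group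
    -- Uniqueness of the fixed coset puts the element conjugating one normal form to the other in
    -- `⟨γ i, c⟩`, which is commutative, so the two forms coincide.
    have hcomm : Commute (x⁻¹ * y⁻¹) (γ i ^ w * c ^ s) := by
      rw [hyx]
      have h1 : Commute (γ i ^ a) (γ i ^ w) :=
        ((Commute.refl (γ i)).zpow_left a).pow_right w
      exact (h1.mul_right (hcentral s _)).mul_left ((hcentral b _).symm)
    have heq : γ i ^ v * c ^ (k / e i + l) = γ i ^ w * c ^ s := by
      have h1 : x⁻¹ * g * x = (x⁻¹ * y⁻¹) * (y * g * y⁻¹) * (x⁻¹ * y⁻¹)⁻¹ := by group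
      rw [← hgv, h1, hy, hcomm.eq, mul_inv_cancel_right]
    have hvw : v = w := by
      have h1 := congrArg (QuotientGroup.mk : P → P ⧸ Subgroup.zpowers c) heq
      rw [QuotientGroup.mk_mul, QuotientGroup.mk_mul, QuotientGroup.mk_pow, QuotientGroup.mk_pow,
        hcq s,
        hcq (k / e i + l), mul_one, mul_one] at h1
      exact pow_injOn_Iio_orderOf (by rw [hQ.orderOf_eq]; exact hve)
        (by rw [hQ.orderOf_eq]; exact hwe) h1
    subst hvw
    have hus := hP.zpow_injective htf he0 hg1 (mul_left_cancel heq)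
    rw [hus]

end IsStandardGenerators

theorem mainTheorem6 (n : ℕ) (e : Fin n → ℕ) (he : ∀ i, 2 ≤ e i)
    (hμ : 0 < (n : ℝ) - 2 - ∑ i, 1 / (e i : ℝ))
    (P : Subgroup SU11Cover) (γ : Fin n → P) (c : P) (hP : IsStandardGenerators e γ c)
    (g : P) (hg : (g : P ⧸ Subgroup.center P) ≠ 1)
    (hfin : IsOfFinOrder (g : P ⧸ Subgroup.center P)) :
    ∃! t : Fin n × ℕ × ℤ,
      0 < t.2.1 ∧ t.2.1 < e t.1 ∧ IsConj g (γ t.1 ^ t.2.1 * c ^ t.2.2) := by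
  have hn : 2 ≤ n := by
    have h1 : 0 ≤ ∑ i, 1 / (e i : ℝ) := Finset.sum_nonneg fun i _ => by positivity
    have h2 : (2 : ℝ) ≤ n := by linarith
    exact_mod_cast h2
  obtain ⟨m, hm, hgm⟩ := isOfFinOrder_iff_pow_eq_one.1 hfin
  rw [Ne, QuotientGroup.eq_one_iff] at hg
  rw [← QuotientGroup.mk_pow, QuotientGroup.eq_one_iff] at hgm
  refine hP.existsUnique_isConj (fun a m hm ha => Subtype.ext ?_) he hn g hg hm hgm
  exact SU11Cover.eq_one_of_pow_eq_one hm (by simpa using congrArg Subtype.val ha)
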